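/- Let $\mathcal{G}$ be a locally compact Hausdorff groupoid with unit space $\mathcal{G}^{(0)}$, range and source maps $r(x)=xx^{-1}$, $s(x)=x^{-1}x$, and let $u\in\mathcal{G}^{(0)}$. Write $\mathcal{G}^v=r^{-1}(v)$, and let $\mathcal{G}_u^u=\{x\in\mathcal{G}: r(x)=s(x)=u\}$ be the isotropy group at $u$, with the subspace topology. A continuous Hilbert field $\mathfrak{H}$ over $\mathcal{G}^{(0)}$ is a family $(\mathfrak{H}_v)_{v\in\mathcal{G}^{(0)}}$ of complex Hilbert spaces with a linear space $\Gamma\subseteq\prod_v\mathfrak{H}_v$ (the continuous sections) such that $\{\xi(v):\xi\in\Gamma\}$ is dense in $\mathfrak{H}_v$ for every $v$, the function $v\mapsto\|\xi(v)\|$ is continuous for every $\xi\in\Gamma$, and $\Gamma$ contains every section that can, near each point and for each $\varepsilon>0$, be approximated within $\varepsilon$ by an element of $\Gamma$. Let $\Delta_b(\mathfrak{H})$ be the set of $\xi\in\Gamma$ with $\|\xi\|_\Delta:=\sup_v\|\xi(v)\|<\infty$. A representation of $\mathcal{G}$ on $\mathfrak{H}$ is a family of unitary maps $\varpi(x):\mathfrak{H}_{s(x)}\to\mathfrak{H}_{r(x)}$,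 $x\in\mathcal{G}$, with $\varpi(xy)=\varpi(x)\varpi(y)$ for all composable $(x,y)$, such that for all $\xi,\eta\in\Delta_b(\mathfrak{H})$ the coefficient $\mathfrak{H}_{\xi,\eta}(x)=\langle\varpi(x)\xi(s(x)),\eta(r(x))\rangle$ is continuous on $\mathcal{G}$. The Fourier–Stieltjes algebra $B(\mathcal{G})$ is the algebra, under pointwise operations, of all such coefficients, with norm $\|\varphi\|_{B(\mathcal{G})}=\inf\{\|\xi\|_\Delta\|\eta\|_\Delta:\varphi=\mathfrak{H}_{\xi,\eta}\}$. If $\mathcal{G}$ has a left Haar system $\{\lambda^v\}_{v\in\mathcal{G}^{(0)}}$, the Fourier algebra $A(\mathcal{G})$ is the $\|\cdot\|_{B(\mathcal{G})}$-closure in $B(\mathcal{G})$ of the algebra $A_c(\mathcal{G})$ generated by the functions $\Lambda_{f,g}(x)=\int_{\mathcal{G}^{r(x)}}f(x^{-1}z)\overline{g(z)}\,d\lambda^{r(x)}(z)$, $f,g\in C_c(\mathcal{G})$. A continuous unitary representation of a locally compact group $K$ is a homomorphism $\pi$ from $K$ to the unitary group of a Hilbert space whose coefficients $\pi_{\xi,\eta}(x)=\langle\pi(x)\xi,\eta\rangle$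 are all continuous; $B(K)$ is the algebra of all such coefficients, with norm $\|\varphi\|_{B(K)}=\inf\{\|\xi\|\|\eta\|:\varphi=\pi_{\xi,\eta}\}$, and $A(K)$ is the $\|\cdot\|_{B(K)}$-closure in $B(K)$ of the set of compactly supported functions in $B(K)$. Then: 1. For every continuous Hilbert field $\mathfrak{H}$ over $\mathcal{G}^{(0)}$ and every representation $\varpi$ of $\mathcal{G}$ on $\mathfrak{H}$, the map $\mathcal{G}_u^u\to\mathcal{U}(\mathfrak{H}_u)$, $x\mapsto\varpi(x)$, is a continuous unitary representation of $\mathcal{G}_u^u$. 2. The map $\varphi\mapsto\varphi|_{\mathcal{G}_u^u}$ is a contractive algebra homomorphism $B(\mathcal{G})\to B(\mathcal{G}_u^u)$; that is, it is well defined, it is a homomorphism of algebras, and $\|\varphi|_{\mathcal{G}_u^u}\|_{B(\mathcal{G}_u^u)}\le\|\varphi\|_{B(\mathcal{G})}$. 3. If $\mathcal{G}$ has a left Haar system, and $A(\mathcal{G})$ is formed with it, then the map in 2 restricts to a contractive algebra homomorphism $A(\mathcal{G})\to A(\mathcal{G}_u^u)$, both algebras carrying the norms in 2. -/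

import Mathlib

universe u v

namespace GroupoidFourier

/-! ### Groupoids -/

/-- A groupoid as a set with a partially defined product.  `Comp a b` says that `(a, b)` is a
composable pair.  The product is a total function for convenience: its values on pairs that are
not composable are irrelevant, no axiom or definition below refers to them. -/
class AlgGroupoid (G : Type u) extends Mul G, Inv G where
  Comp : G → G → Prop
  inv_inv' : ∀ a : G, a⁻¹⁻¹ = a
  assoc' : ∀ a b c : G, Comp a b → Comp b c →
    Comp (a * b) c ∧ Comp a (b * c) ∧ (a * b) * c = a * (b * c)
  comp_inv' : ∀ b : G, Comp b b⁻¹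
  inv_mul_cancel_left' : ∀ a b : G, Comp a b → a⁻¹ * (a * b) = b
  mul_inv_cancel_right' : ∀ a b : G, Comp a b → (a * b) * b⁻¹ = a

section Algebra

variable {G : Type u} [AlgGroupoid G]

open AlgGroupoid

/-- The unit space `{a a⁻¹ : a ∈ G}`. -/
def unitSpace (G : Type u) [AlgGroupoid G] : Set G := Set.range fun a : G => a * a⁻¹

/-- The range map `r(a) = a a⁻¹`. -/
def rng (a : G) : unitSpace G := ⟨a * a⁻¹, a, rfl⟩

/-- The source map `s(a) = a⁻¹ a`. -/
def src (a : G) : unitSpace G := ⟨a⁻¹ * a, a⁻¹, by simp only [inv_inv']⟩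

theorem comp_inv_left (a : G) : Comp a⁻¹ a := by
  simpa only [inv_inv'] using comp_inv' a⁻¹

theorem rng_mul_self (a : G) : (a * a⁻¹) * a = a := by
  simpa only [inv_inv'] using mul_inv_cancel_right' a a⁻¹ (comp_inv' a)

theorem mul_src_self (a : G) : a * (a⁻¹ * a) = a := by
  simpa only [inv_inv'] using inv_mul_cancel_left' a⁻¹ a (comp_inv_left a)

theorem comp_of_src_eq_rng {a b : G} (h : src a = rng b) : Comp a b := by
  have h' : a⁻¹ * a = b * b⁻¹ := congrArg Subtype.val h
  have h1 : Comp a (a⁻¹ * a) := (assoc' a a⁻¹ a (comp_inv' a) (comp_inv_left a)).2.1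
  have h2 : Comp (b * b⁻¹) b := (assoc' b b⁻¹ b (comp_inv' b) (comp_inv_left b)).1
  rw [h'] at h1
  have h3 := (assoc' a (b * b⁻¹) b h1 h2).2.1
  rwa [rng_mul_self] at h3

theorem rng_mul {a b : G} (h : Comp a b) : rng (a * b) = rng a := by
  apply Subtype.ext
  change (a * b) * (a * b)⁻¹ = a * a⁻¹
  -- `c := a b` satisfies `c b⁻¹ = a`, and `(c c⁻¹) (c b⁻¹) = c b⁻¹`
  have hcb : Comp (a * b) b⁻¹ := (assoc' a b b⁻¹ h (comp_inv' b)).1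
  have e1 : (a * b) * b⁻¹ = a := mul_inv_cancel_right' a b h
  have hcc : Comp ((a * b) * (a * b)⁻¹) (a * b) :=
    (assoc' _ _ _ (comp_inv' (a * b)) (comp_inv_left (a * b))).1
  have k := assoc' _ _ _ hcc hcb
  rw [rng_mul_self, e1] at k
  have k2 := mul_inv_cancel_right' _ _ k.2.1
  rw [← k.2.2] at k2
  exact k2.symm

theorem src_mul {a b : G} (h : Comp a b) : src (a * b) = src b := by
  apply Subtype.ext
  change (a * b)⁻¹ * (a * b) = b⁻¹ * b
  have hac : Comp a⁻¹ (a * b) := (assoc' a⁻¹ a b (comp_inv_left a) h).2.1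
  have e1 : a⁻¹ * (a * b) = b := inv_mul_cancel_left' a b h
  have hcc : Comp (a * b) ((a * b)⁻¹ * (a * b)) :=
    (assoc' _ _ _ (comp_inv' (a * b)) (comp_inv_left (a * b))).2.1
  have k := assoc' _ _ _ hac hcc
  rw [mul_src_self, e1] at k
  have k2 := inv_mul_cancel_left' _ _ k.1
  rw [k.2.2] at k2
  exact k2.symm

theorem rng_inv (a : G) : rng a⁻¹ = src a := by
  apply Subtype.ext
  change a⁻¹ * a⁻¹⁻¹ = a⁻¹ * a
  rw [inv_inv']

theorem src_inv (a : G) : src a⁻¹ = rng a := by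
  apply Subtype.ext
  change a⁻¹⁻¹ * a⁻¹ = a * a⁻¹
  rw [inv_inv']

theorem rng_unit (w : unitSpace G) : rng (w : G) = w := by
  obtain ⟨_, a, rfl⟩ := w
  exact rng_mul (comp_inv' a)

theorem src_unit (w : unitSpace G) : src (w : G) = w := by
  obtain ⟨_, a, rfl⟩ := w
  exact (src_mul (comp_inv' a)).trans (src_inv a)

/-- The set `𝒢_a^b` of arrows with source `a` and range `b`. -/
abbrev Arrow (a b : unitSpace G) : Type u := {x : G // src x = a ∧ rng x = b}

/-- An element of the groupoid as an arrow from its source to its range. -/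
def toArrow (x : G) : Arrow (src x) (rng x) := ⟨x, rfl, rfl⟩

/-- The product of two composable arrows. -/
def Arrow.comp {a b c : unitSpace G} (x : Arrow b c) (y : Arrow a b) : Arrow a c :=
  have h : Comp x.1 y.1 := comp_of_src_eq_rng (x.2.1.trans y.2.2.symm)
  ⟨x.1 * y.1, (src_mul h).trans y.2.1, (rng_mul h).trans x.2.2⟩

/-- The isotropy group `𝒢_w^w`. -/
abbrev Isotropy (w : unitSpace G) : Type u := Arrow w w

/-- The group structure of `𝒢_w^w`: the product and inverse of the groupoid, with neutral
element `w`. -/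
instance Isotropy.instGroup (w : unitSpace G) : Group (Isotropy w) where
  mul x y := x.comp y
  one := ⟨w, src_unit w, rng_unit w⟩
  inv x := ⟨x.1⁻¹, (src_inv x.1).trans x.2.2, (rng_inv x.1).trans x.2.1⟩
  mul_assoc x y z := Subtype.ext
    (assoc' x.1 y.1 z.1 (comp_of_src_eq_rng (x.2.1.trans y.2.2.symm))
      (comp_of_src_eq_rng (y.2.1.trans z.2.2.symm))).2.2
  one_mul x := Subtype.ext (by
    have h : x.1 * x.1⁻¹ = (w : G) := congrArg Subtype.val x.2.2
    change (w : G) * x.1 = x.1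
    rw [← h, rng_mul_self])
  mul_one x := Subtype.ext (by
    have h : x.1⁻¹ * x.1 = (w : G) := congrArg Subtype.val x.2.1
    change x.1 * (w : G) = x.1
    rw [← h, mul_src_self])
  inv_mul_cancel x := Subtype.ext (by
    have h : x.1⁻¹ * x.1 = (w : G) := congrArg Subtype.val x.2.1
    exact h)

end Algebra

/-- A topological groupoid: inversion is continuous, and the product is continuous on the set of
composable pairs with the relative topology. -/
class TopologicalGroupoid (G : Type u) [AlgGroupoid G] [TopologicalSpace G] : Prop where
  continuous_inv : Continuous fun a : G => a⁻¹
  continuousOn_mul : ContinuousOn (fun p : G × G => p.1 * p.2) {p | AlgGroupoid.Comp p.1 p.2}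

/-! ### Continuous Hilbert fields and groupoid representations -/

/-- A continuous field of (complex) Hilbert spaces over `T`, with its space of continuous
sections. -/
structure ContinuousHilbertField (T : Type u) [TopologicalSpace T] where
  fiber : T → Type v
  [normedAddCommGroup : ∀ t, NormedAddCommGroup (fiber t)]
  [innerProductSpace : ∀ t, InnerProductSpace ℂ (fiber t)]
  [completeSpace : ∀ t, CompleteSpace (fiber t)]
  /-- the continuous sections -/
  sections : Submodule ℂ (∀ t, fiber t)
  dense_eval : ∀ t, Dense {w : fiber t | ∃ ξ ∈ sections, ξ t = w}
  continuous_norm : ∀ ξ ∈ sections, Continuous fun t => ‖ξ t‖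
  mem_of_locally_approx : ∀ ξ : ∀ t, fiber t,
    (∀ t, ∀ ε : ℝ, 0 < ε → ∃ ξ' ∈ sections, ∀ᶠ τ in nhds t, ‖ξ τ - ξ' τ‖ < ε) → ξ ∈ sections

attribute [instance] ContinuousHilbertField.normedAddCommGroup
  ContinuousHilbertField.innerProductSpace ContinuousHilbertField.completeSpace

/-- `Δ_b(𝓗)`: the continuous sections with bounded norm. -/
def ContinuousHilbertField.boundedSections {T : Type u} [TopologicalSpace T]
    (H : ContinuousHilbertField.{u, v} T) : Set (∀ t, H.fiber t) :=
  {ξ | ξ ∈ H.sections ∧ BddAbove (Set.range fun t => ‖ξ t‖)}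

/-- The section norm `sup_t ‖ξ(t)‖`; it is used for bounded sections only. -/
noncomputable def ContinuousHilbertField.sectionNorm {T : Type u} [TopologicalSpace T]
    (H : ContinuousHilbertField.{u, v} T) (ξ : ∀ t, H.fiber t) : ℝ := ⨆ t, ‖ξ t‖

/-- A continuous unitary representation of `G` on a continuous Hilbert field over the unit space.
Mathlib's inner product is linear in the second argument, so `inner ℂ η ξ` is `⟨ξ, η⟩` in
the convention where the first argument is the linear one. -/
structure GroupoidRep (G : Type u) [AlgGroupoid G] [TopologicalSpace G]
    (H : ContinuousHilbertField.{u, v} (unitSpace G)) where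
  map : ∀ {a b : unitSpace G}, Arrow a b → (H.fiber a ≃ₗᵢ[ℂ] H.fiber b)
  continuous_coeff : ∀ ξ ∈ H.boundedSections, ∀ η ∈ H.boundedSections,
    Continuous fun x : G => inner ℂ (η (rng x)) (map (toArrow x) (ξ (src x)))
  map_comp : ∀ {a b c : unitSpace G} (x : Arrow b c) (y : Arrow a b) (w : H.fiber a),
    map (x.comp y) w = map x (map y w)

/-- The coefficient `x ↦ ⟨ϖ(x) ξ(s(x)), η(r(x))⟩`. -/
noncomputable def GroupoidRep.coeff {G : Type u} [AlgGroupoid G] [TopologicalSpace G]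
    {H : ContinuousHilbertField.{u, v} (unitSpace G)} (ϖ : GroupoidRep G H)
    (ξ η : ∀ t, H.fiber t) : G → ℂ :=
  fun x => inner ℂ (η (rng x)) (ϖ.map (toArrow x) (ξ (src x)))

/-! ### The Fourier–Stieltjes and Fourier algebras of a groupoid -/

section GroupoidAlgebras

variable (G : Type u) [AlgGroupoid G] [TopologicalSpace G]

/-- The underlying set of `B(𝒢)`.  The fibres live in the universe of `G`; this is no restriction,
as every coefficient is already a coefficient of an invariant subfield generated by a family of
sections of cardinality at most that of `G` and the continuum. -/
def fourierStieltjes : Set (G → ℂ) :=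
  {φ | ∃ (H : ContinuousHilbertField.{u, u} (unitSpace G)) (ϖ : GroupoidRep G H),
    ∃ ξ ∈ H.boundedSections, ∃ η ∈ H.boundedSections, φ = ϖ.coeff ξ η}

variable {G}

/-- The norm of `B(𝒢)`: the infimum of `‖ξ‖ ‖η‖` over all representations of `φ` as a
coefficient. It is meaningful for `φ ∈ B(𝒢)` only. -/
noncomputable def fsNorm (φ : G → ℂ) : ℝ :=
  sInf {c | ∃ (H : ContinuousHilbertField.{u, u} (unitSpace G)) (ϖ : GroupoidRep G H),
    ∃ ξ ∈ H.boundedSections, ∃ η ∈ H.boundedSections,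
      φ = ϖ.coeff ξ η ∧ c = H.sectionNorm ξ * H.sectionNorm η}

variable (G)

open MeasureTheory

/-- A continuous left Haar system. -/
structure HaarSystem [MeasurableSpace G] where
  /-- the measure `λ^w` on `𝒢^w = r⁻¹{w}` -/
  measure : ∀ w : unitSpace G, Measure {x : G // rng x = w}
  regular : ∀ w, (measure w).Regular
  /-- full support -/
  isOpenPos : ∀ w, (measure w).IsOpenPosMeasure
  continuous_integral : ∀ g : G → ℂ, Continuous g → HasCompactSupport g →
    Continuous (fun w : unitSpace G => ∫ z, g z.1 ∂(measure w)) ∧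
      HasCompactSupport (fun w : unitSpace G => ∫ z, g z.1 ∂(measure w))
  left_invariant : ∀ (x : G) (f : G → ℂ), Continuous f → HasCompactSupport f →
    ∫ z, f (x * z.1) ∂(measure (src x)) = ∫ z, f z.1 ∂(measure (rng x))

variable {G}
variable [MeasurableSpace G]

/-- The coefficient `Λ_{f,g}(x) = ⟨L_x f^{s(x)}, g^{r(x)}⟩` of the left regular representation in
`L²(𝒢^{r(x)}, λ^{r(x)})`, where `(L_x f)(z) = f(x⁻¹ z)`. -/
noncomputable def HaarSystem.regularCoeff (lam : HaarSystem G) (f g : G → ℂ) : G → ℂ :=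
  fun x => ∫ z, f (x⁻¹ * z.1) * (starRingEnd ℂ) (g z.1) ∂(lam.measure (rng x))

/-- `A_c(𝒢)`: the algebra generated under pointwise operations by the `Λ_{f,g}` with
`f, g ∈ C_c(𝒢)`. -/
noncomputable def HaarSystem.fourierCore (lam : HaarSystem G) :
    NonUnitalSubalgebra ℂ (G → ℂ) :=
  NonUnitalAlgebra.adjoin ℂ {φ | ∃ f g : G → ℂ, Continuous f ∧ HasCompactSupport f ∧
    Continuous g ∧ HasCompactSupport g ∧ φ = lam.regularCoeff f g}

/-- The underlying set of `A(𝒢)`: the closure of `A_c(𝒢)` in `B(𝒢)` for the norm of `B(𝒢)`. -/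
def HaarSystem.fourier (lam : HaarSystem G) : Set (G → ℂ) :=
  {φ | φ ∈ fourierStieltjes G ∧ ∀ ε : ℝ, 0 < ε → ∃ ψ ∈ lam.fourierCore,
    φ - ψ ∈ fourierStieltjes G ∧ fsNorm (φ - ψ) < ε}

end GroupoidAlgebras

/-! ### Groups -/

/-- A continuous unitary representation of a topological group `K` on a Hilbert space `E`: a
homomorphism into the unitary group of `E` with continuous coefficient functions. -/
structure UnitaryRep (K : Type u) [Group K] [TopologicalSpace K]
    (E : Type v) [NormedAddCommGroup E] [InnerProductSpace ℂ E] where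
  hom : K →* (E ≃ₗᵢ[ℂ] E)
  continuous_coeff : ∀ ξ η : E, Continuous fun x : K => inner ℂ η (hom x ξ)

section GroupAlgebras

variable (K : Type u) [Group K] [TopologicalSpace K]

/-- The underlying set of the Fourier–Stieltjes algebra `B(K)` of a group: the coefficients
`x ↦ ⟨π(x) ξ, η⟩` of its continuous unitary representations. -/
def groupFourierStieltjes : Set (K → ℂ) :=
  {φ | ∃ (E : Type u) (_ : NormedAddCommGroup E) (_ : InnerProductSpace ℂ E)
    (_ : CompleteSpace E) (π : UnitaryRep K E) (ξ η : E), φ = fun x => inner ℂ η (π.hom x ξ)}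

variable {K}

/-- The norm of `B(K)`: the infimum of `‖ξ‖ ‖η‖` over all representations of `φ` as a
coefficient. It is meaningful for `φ ∈ B(K)` only. -/
noncomputable def groupFsNorm (φ : K → ℂ) : ℝ :=
  sInf {c | ∃ (E : Type u) (_ : NormedAddCommGroup E) (_ : InnerProductSpace ℂ E)
    (_ : CompleteSpace E) (π : UnitaryRep K E) (ξ η : E),
      (φ = fun x => inner ℂ η (π.hom x ξ)) ∧ c = ‖ξ‖ * ‖η‖}

variable (K)

/-- The underlying set of the Fourier algebra `A(K)` of a locally compact group: the closure in
`B(K)` of the set (it is an ideal) of the compactly supported functions in `B(K)`. -/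
def groupFourier : Set (K → ℂ) :=
  {φ | φ ∈ groupFourierStieltjes K ∧ ∀ ε : ℝ, 0 < ε →
    ∃ ψ ∈ groupFourierStieltjes K, HasCompactSupport ψ ∧
      φ - ψ ∈ groupFourierStieltjes K ∧ groupFsNorm (φ - ψ) < ε}

end GroupAlgebras

end GroupoidFourier

open GroupoidFourier

namespace GroupoidFourier

open AlgGroupoid Topology

/-! ### Topology of the range and source maps and of isotropy groups. -/

section Topology

variable {G : Type u} [AlgGroupoid G] [TopologicalSpace G] [TopologicalGroupoid G]

/-! On `Isotropy w` a representation `ϖ` is a homomorphism into the unitary group of the fibre at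
`w`, so only continuity is at stake. Coefficients of bounded sections are continuous on the
groupoid, which settles vectors of the form `ξ w` with `ξ` bounded. These are dense, because a
continuous section can be damped by a positive continuous function without changing its value at `w`
(`exists_boundedSection_eq`). Since the maps are isometric, a coefficient depends on its two vectors
uniformly in the group element, and a uniform limit of continuous functions is continuous
(`continuous_inner_of_dense`).

Hence the coefficient of `ξ, η` restricts to the coefficient of `ξ w, η w`. As `‖ξ w‖ ≤ sup ‖ξ‖`,
taking infima gives the contraction (`groupFsNorm_restrict_le`). Restriction respects pointwise
operations automatically; the real work is that source and target are algebras. In `B(𝒢)` sums come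
from direct sums, products from Hilbert tensor products and the unit from the trivial
representation; the same constructions show that the norm is subadditive and submultiplicative. For
`B(K)` nothing is repeated: a group is a groupoid with one unit, and both sets and norms agree
(`groupFourierStieltjes_eq`, `groupFsNorm_eq_fsNorm`). The Fourier algebras are then closures of
algebras for a submultiplicative seminorm (`seminormClosure`).

For the Fourier algebra, `Λ_{f,g}` vanishes off the compact set of products `z y⁻¹` with `z ∈ supp
g`, `y ∈ supp f` and `s(z) = s(y)` (`hasCompactSupport_regularCoeff`), so all of `A_c(𝒢)` is
compactly supported. The isotropy group is closed, so approximants from `A_c(𝒢)` restrict to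
compactly supported functions, and contractivity preserves the approximation. -/

theorem continuous_rng : Continuous (rng : G → unitSpace G) :=
  Continuous.subtype_mk (TopologicalGroupoid.continuousOn_mul.comp_continuous
    (continuous_id.prodMk TopologicalGroupoid.continuous_inv) comp_inv') _

theorem continuous_src : Continuous (src : G → unitSpace G) :=
  Continuous.subtype_mk (TopologicalGroupoid.continuousOn_mul.comp_continuous
    (TopologicalGroupoid.continuous_inv.prodMk continuous_id) comp_inv_left) _

theorem isClosed_isotropy [T2Space G] (w : unitSpace G) :
    IsClosed {x : G | src x = w ∧ rng x = w} :=
  (isClosed_eq continuous_src continuous_const).inter (isClosed_eq continuous_rng continuous_const)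

instance Isotropy.instIsTopologicalGroup (w : unitSpace G) : IsTopologicalGroup (Isotropy w) where
  continuous_mul := Continuous.subtype_mk (TopologicalGroupoid.continuousOn_mul.comp_continuous
    ((continuous_subtype_val.comp continuous_fst).prodMk
      (continuous_subtype_val.comp continuous_snd))
    fun p => comp_of_src_eq_rng (p.1.2.1.trans p.2.2.2.symm)) _
  continuous_inv := Continuous.subtype_mk
    (TopologicalGroupoid.continuous_inv.comp continuous_subtype_val) _

end Topology

/-! ### Bounded sections of a continuous Hilbert field. -/

namespace ContinuousHilbertField

variable {T : Type u} [TopologicalSpace T] (H : ContinuousHilbertField.{u, v} T)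

/-- Near `t` the section is approximated by `f t • ξ`: the error `‖f τ - f t‖ * ‖ξ τ‖` is continuous
in `τ` and vanishes at `t`, so the local approximation axiom applies. -/
theorem smul_mem_sections {f : T → ℂ} (hf : Continuous f) {ξ : ∀ t, H.fiber t}
    (hξ : ξ ∈ H.sections) : (fun t => f t • ξ t) ∈ H.sections := by
  refine H.mem_of_locally_approx _ fun t ε hε => ⟨f t • ξ, H.sections.smul_mem _ hξ, ?_⟩
  have hc : Continuous fun τ => ‖f τ - f t‖ * ‖ξ τ‖ :=
    (hf.sub continuous_const).norm.mul (H.continuous_norm ξ hξ)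
  have h0 : ‖f t - f t‖ * ‖ξ t‖ < ε := by simpa using hε
  filter_upwards [hc.continuousAt.eventually_lt continuousAt_const h0] with τ hτ
  rwa [Pi.smul_apply, ← sub_smul, norm_smul]

theorem exists_boundedSection_eq {ξ : ∀ t, H.fiber t} (hξ : ξ ∈ H.sections) (t : T) :
    ∃ η ∈ H.boundedSections, η t = ξ t := by
  have hpos : ∀ τ, (0 : ℝ) < 1 + ‖ξ τ‖ := fun τ => by positivity
  -- This factor equals 1 at `t` and makes the norm of the section at most `1 + ‖ξ t‖` everywhere;
  -- adding 1 keeps the denominator positive.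
  have hc : Continuous fun τ => (((1 + ‖ξ t‖) / (1 + ‖ξ τ‖) : ℝ) : ℂ) :=
    Complex.continuous_ofReal.comp (continuous_const.div
      (continuous_const.add (H.continuous_norm ξ hξ)) fun τ => (hpos τ).ne')
  refine ⟨_, ⟨H.smul_mem_sections hc hξ, 1 + ‖ξ t‖, ?_⟩, ?_⟩
  · rintro _ ⟨τ, rfl⟩
    have h1 := hpos t
    have h2 := hpos τ
    simp only [norm_smul, Complex.norm_real, Real.norm_eq_abs]
    rw [abs_of_nonneg (by positivity), div_mul_eq_mul_div, div_le_iff₀ h2]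
    nlinarith [norm_nonneg (ξ τ)]
  · simp [div_self (hpos t).ne']

theorem dense_eval_boundedSections (t : T) :
    Dense {w : H.fiber t | ∃ ξ ∈ H.boundedSections, ξ t = w} := by
  refine (H.dense_eval t).mono ?_
  rintro _ ⟨ξ, hξ, rfl⟩
  exact H.exists_boundedSection_eq hξ t

/-- The bounded sections as a subspace of the product of the fibres. -/
def boundedSubmodule : Submodule ℂ (∀ t, H.fiber t) where
  carrier := H.boundedSections
  zero_mem' := ⟨H.sections.zero_mem, 0, by rintro _ ⟨t, rfl⟩; simp⟩
  add_mem' := by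
    rintro ξ η ⟨hξ, a, ha⟩ ⟨hη, b, hb⟩
    refine ⟨H.sections.add_mem hξ hη, a + b, ?_⟩
    rintro _ ⟨t, rfl⟩
    exact (norm_add_le _ _).trans (add_le_add (ha ⟨t, rfl⟩) (hb ⟨t, rfl⟩))
  smul_mem' := by
    rintro c ξ ⟨hξ, a, ha⟩
    refine ⟨H.sections.smul_mem c hξ, ‖c‖ * a, ?_⟩
    rintro _ ⟨t, rfl⟩
    simp only [Pi.smul_apply, norm_smul]
    exact mul_le_mul_of_nonneg_left (ha ⟨t, rfl⟩) (norm_nonneg c)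

/-- Polarization: a field only postulates continuity of norms, and the inner product is a
combination of squared norms of four sections. -/
theorem continuous_inner_sections {ξ η : ∀ t, H.fiber t} (hξ : ξ ∈ H.sections)
    (hη : η ∈ H.sections) : Continuous fun t => inner ℂ (ξ t) (η t) := by
  simp_rw [inner_eq_sum_norm_sq_div_four (𝕜 := ℂ)]
  have h1 := H.continuous_norm _ (H.sections.add_mem hξ hη)
  have h2 := H.continuous_norm _ (H.sections.sub_mem hξ hη)
  have h3 := H.continuous_norm _
    (H.sections.sub_mem hξ (H.sections.smul_mem (RCLike.I : ℂ) hη))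
  have h4 := H.continuous_norm _
    (H.sections.add_mem hξ (H.sections.smul_mem (RCLike.I : ℂ) hη))
  simp only [Pi.add_apply, Pi.sub_apply, Pi.smul_apply] at h1 h2 h3 h4
  refine Continuous.div_const (.add (.sub ?_ ?_) (.mul (.sub ?_ ?_) continuous_const)) _
  all_goals exact (Complex.continuous_ofReal.comp (by assumption)).pow 2

theorem sectionNorm_nonneg (ξ : ∀ t, H.fiber t) : 0 ≤ H.sectionNorm ξ :=
  Real.iSup_nonneg fun _ => norm_nonneg _

theorem norm_le_sectionNorm {ξ : ∀ t, H.fiber t} (hξ : ξ ∈ H.boundedSections) (t : T) :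
    ‖ξ t‖ ≤ H.sectionNorm ξ :=
  le_ciSup hξ.2 t

theorem sectionNorm_le {ξ : ∀ t, H.fiber t} {a : ℝ} (ha : 0 ≤ a) (h : ∀ t, ‖ξ t‖ ≤ a) :
    H.sectionNorm ξ ≤ a :=
  Real.iSup_le h ha

theorem sectionNorm_smul_le {ξ : ∀ t, H.fiber t} (hξ : ξ ∈ H.boundedSections) (c : ℂ) :
    H.sectionNorm (c • ξ) ≤ ‖c‖ * H.sectionNorm ξ :=
  H.sectionNorm_le (mul_nonneg (norm_nonneg _) (H.sectionNorm_nonneg _)) fun t => by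
    rw [Pi.smul_apply, norm_smul]
    exact mul_le_mul_of_nonneg_left (H.norm_le_sectionNorm hξ t) (norm_nonneg c)

end ContinuousHilbertField

/-- If a sesquilinear family of coefficients is continuous for vectors in dense sets, it is
continuous for all vectors. -/
theorem continuous_inner_of_dense {X : Type*} [TopologicalSpace X] {E : Type*}
    [NormedAddCommGroup E] [InnerProductSpace ℂ E] {U : X → E ≃ₗᵢ[ℂ] E} {D : Set E}
    (hD : Dense D) (h : ∀ ξ ∈ D, ∀ η ∈ D, Continuous fun x => inner ℂ η (U x ξ)) (ξ η : E) :
    Continuous fun x => inner ℂ η (U x ξ) := by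
  have key : ∀ (p : E × E) (ε : ℝ), 0 < ε → ∃ q ∈ D ×ˢ D, ∀ x,
      dist (inner ℂ p.2 (U x p.1)) (inner ℂ q.2 (U x q.1)) < ε := by
    intro p ε hε
    -- This bounds the change of the coefficient from `p` to `q`. It does not involve `x`, since `U
    -- x` is isometric, and it vanishes at `q = p`.
    have hc : ContinuousAt
        (fun q : E × E => ‖p.2 - q.2‖ * ‖p.1‖ + ‖q.2‖ * ‖p.1 - q.1‖) p := by fun_prop
    have hev := hc.eventually_lt (continuousAt_const (y := ε)) (by simpa using hε)
    obtain ⟨q, hq, hqD⟩ := ((hD.prod hD).inter_nhds_nonempty hev).imp fun q hq => hq.symm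
    refine ⟨q, hqD, fun x => lt_of_le_of_lt ?_ hq⟩
    have e : inner ℂ p.2 (U x p.1) - inner ℂ q.2 (U x q.1)
        = inner ℂ (p.2 - q.2) (U x p.1) + inner ℂ q.2 (U x (p.1 - q.1)) := by
      rw [map_sub, inner_sub_left, inner_sub_right]; ring
    rw [dist_eq_norm, e]
    refine (norm_add_le _ _).trans (add_le_add ?_ ?_)
    · simpa only [LinearIsometryEquiv.norm_map] using
        norm_inner_le_norm (𝕜 := ℂ) (p.2 - q.2) (U x p.1)
    · simpa only [LinearIsometryEquiv.norm_map] using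
        norm_inner_le_norm (𝕜 := ℂ) q.2 (U x (p.1 - q.1))
  refine continuous_of_uniform_approx_of_continuous fun V hV => ?_
  obtain ⟨ε, hε, hεV⟩ := Metric.mem_uniformity_dist.1 hV
  obtain ⟨q, hq, hqe⟩ := key (ξ, η) ε hε
  exact ⟨_, h q.1 hq.1 q.2 hq.2, fun x => hεV (hqe x)⟩

/-! ### Restriction of a representation to an isotropy group. -/

namespace GroupoidRep

variable {G : Type u} [AlgGroupoid G] [TopologicalSpace G]
  {H : ContinuousHilbertField.{u, v} (unitSpace G)} (ϖ : GroupoidRep G H)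

/-- Coefficients are defined with the endpoints `src x` and `rng x`. Eliminating the two endpoint
equalities moves them to the prescribed fibres without casts. -/
theorem coeff_arrow {a b : unitSpace G} (x : Arrow a b) (ξ η : ∀ t, H.fiber t) :
    ϖ.coeff ξ η x.1 = inner ℂ (η b) (ϖ.map x (ξ a)) := by
  obtain ⟨x, rfl, rfl⟩ := x
  rfl

/-- The restriction of a groupoid representation to an isotropy group. -/
noncomputable def restrict (w : unitSpace G) : UnitaryRep (Isotropy w) (H.fiber w) where
  hom := MonoidHom.mk' (fun x => ϖ.map x) fun x y =>
    LinearIsometryEquiv.ext fun v => ϖ.map_comp x y v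
  continuous_coeff := by
    refine continuous_inner_of_dense (H.dense_eval_boundedSections w) ?_
    rintro _ ⟨ξ, hξ, rfl⟩ _ ⟨η, hη, rfl⟩
    exact ((ϖ.continuous_coeff ξ hξ η hη).comp continuous_subtype_val).congr fun x =>
      ϖ.coeff_arrow x ξ η

end GroupoidRep

/-! ### Constructions of continuous Hilbert fields -/

namespace ContinuousHilbertField

variable {T : Type u} [TopologicalSpace T]

/-- The constant field, whose sections are the continuous functions. -/
def const (T : Type u) [TopologicalSpace T] (E : Type v) [NormedAddCommGroup E]
    [InnerProductSpace ℂ E] [CompleteSpace E] : ContinuousHilbertField.{u, v} T where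
  fiber _ := E
  sections :=
    { carrier := {ξ : T → E | Continuous ξ}
      zero_mem' := continuous_const
      add_mem' := fun h h' => Continuous.add h h'
      smul_mem' := fun c _ h => Continuous.const_smul h c }
  dense_eval t := by
    convert! dense_univ
    exact Set.eq_univ_of_forall fun w => ⟨fun _ => w, continuous_const, rfl⟩
  continuous_norm _ h := Continuous.norm h
  mem_of_locally_approx ξ h := by
    refine continuous_iff_continuousAt.2 fun t =>
      continuousAt_of_locally_uniform_approx_of_continuousAt fun V hV => ?_
    obtain ⟨ε, hε, hεV⟩ := Metric.mem_uniformity_dist.1 hV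
    obtain ⟨ξ', hξ', hev⟩ := h t ε hε
    exact ⟨_, hev, ξ', Continuous.continuousAt hξ',
      fun y hy => hεV ((dist_eq_norm (ξ y) (ξ' y)).trans_lt hy)⟩

/-- The direct sum of two continuous Hilbert fields. -/
noncomputable def directSum (H₁ H₂ : ContinuousHilbertField.{u, v} T) :
    ContinuousHilbertField.{u, v} T where
  fiber t := WithLp 2 (H₁.fiber t × H₂.fiber t)
  sections :=
    { carrier := {ξ | (fun t => (ξ t).fst) ∈ H₁.sections ∧ (fun t => (ξ t).snd) ∈ H₂.sections}
      zero_mem' := ⟨H₁.sections.zero_mem, H₂.sections.zero_mem⟩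
      add_mem' := fun h h' => ⟨H₁.sections.add_mem h.1 h'.1, H₂.sections.add_mem h.2 h'.2⟩
      smul_mem' := fun c _ h => ⟨H₁.sections.smul_mem c h.1, H₂.sections.smul_mem c h.2⟩ }
  dense_eval t := by
    have h := ((H₁.dense_eval t).prod (H₂.dense_eval t))
    have hs : Function.Surjective
        (WithLp.toLp 2 : H₁.fiber t × H₂.fiber t → WithLp 2 (H₁.fiber t × H₂.fiber t)) :=
      fun x => ⟨WithLp.ofLp x, rfl⟩
    refine (hs.denseRange.dense_image (WithLp.prod_continuous_toLp _ _ _) h).mono ?_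
    rintro _ ⟨⟨_, _⟩, ⟨⟨ξ, hξ, rfl⟩, ⟨η, hη, rfl⟩⟩, rfl⟩
    exact ⟨fun t => WithLp.toLp 2 (ξ t, η t), ⟨hξ, hη⟩, rfl⟩
  continuous_norm ξ h := by
    simp_rw [WithLp.prod_norm_eq_of_L2]
    exact (((H₁.continuous_norm _ h.1).pow 2).add ((H₂.continuous_norm _ h.2).pow 2)).sqrt
  mem_of_locally_approx ξ h := by
    refine ⟨H₁.mem_of_locally_approx _ fun t ε hε => ?_,
      H₂.mem_of_locally_approx _ fun t ε hε => ?_⟩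
    · obtain ⟨ξ', hξ', hev⟩ := h t ε hε
      exact ⟨_, hξ'.1, hev.mono fun τ hτ => (WithLp.norm_fst_le _ (ξ τ - ξ' τ)).trans_lt hτ⟩
    · obtain ⟨ξ', hξ', hev⟩ := h t ε hε
      exact ⟨_, hξ'.2, hev.mono fun τ hτ => (WithLp.norm_snd_le _ (ξ τ - ξ' τ)).trans_lt hτ⟩

section Generated

variable {fiber : T → Type v} [∀ t, NormedAddCommGroup (fiber t)]
  [∀ t, InnerProductSpace ℂ (fiber t)]

/-- The sections that are locally uniform limits of elements of `S`. -/
def localClosure (S : Submodule ℂ (∀ t, fiber t)) : Submodule ℂ (∀ t, fiber t) where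
  carrier := {ξ | ∀ t, ∀ ε : ℝ, 0 < ε → ∃ ξ' ∈ S, ∀ᶠ τ in 𝓝 t, ‖ξ τ - ξ' τ‖ < ε}
  zero_mem' t ε hε := ⟨0, S.zero_mem, .of_forall fun τ => by simpa using hε⟩
  add_mem' := by
    intro ξ η hξ hη t ε hε
    obtain ⟨ξ', hξ', h⟩ := hξ t (ε / 2) (half_pos hε)
    obtain ⟨η', hη', h'⟩ := hη t (ε / 2) (half_pos hε)
    refine ⟨ξ' + η', S.add_mem hξ' hη', ?_⟩
    filter_upwards [h, h'] with τ hτ hτ'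
    rw [Pi.add_apply, Pi.add_apply, add_sub_add_comm]
    exact (norm_add_le _ _).trans_lt (by linarith)
  smul_mem' := by
    intro c ξ hξ t ε hε
    -- The added 1 allows division when `c = 0`.
    have hc : (0 : ℝ) < ‖c‖ + 1 := by positivity
    obtain ⟨ξ', hξ', h⟩ := hξ t (ε / (‖c‖ + 1)) (div_pos hε hc)
    refine ⟨c • ξ', S.smul_mem c hξ', ?_⟩
    filter_upwards [h] with τ hτ
    rw [Pi.smul_apply, Pi.smul_apply, ← smul_sub, norm_smul]
    rw [lt_div_iff₀ hc] at hτ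
    nlinarith [norm_nonneg (ξ τ - ξ' τ)]

theorem le_localClosure (S : Submodule ℂ (∀ t, fiber t)) : S ≤ localClosure S :=
  fun ξ hξ _ ε hε => ⟨ξ, hξ, .of_forall fun τ => by simpa using hε⟩

/-- The continuous Hilbert field generated by a space of sections with dense values and
continuous norms. -/
def generated [∀ t, CompleteSpace (fiber t)] (S : Submodule ℂ (∀ t, fiber t))
    (hd : ∀ t, Dense {w : fiber t | ∃ ξ ∈ S, ξ t = w})
    (hc : ∀ ξ ∈ S, Continuous fun t => ‖ξ t‖) : ContinuousHilbertField.{u, v} T where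
  fiber := fiber
  sections := localClosure S
  dense_eval t := (hd t).mono (by
    rintro _ ⟨ξ, hξ, rfl⟩
    exact ⟨ξ, le_localClosure S hξ, rfl⟩)
  continuous_norm ξ hξ := by
    refine continuous_iff_continuousAt.2 fun t =>
      continuousAt_of_locally_uniform_approx_of_continuousAt fun V hV => ?_
    obtain ⟨ε, hε, hεV⟩ := Metric.mem_uniformity_dist.1 hV
    obtain ⟨ξ', hξ', hev⟩ := hξ t ε hε
    exact ⟨_, hev, _, (hc ξ' hξ').continuousAt, fun y hy => hεV
      ((abs_norm_sub_norm_le (ξ y) (ξ' y)).trans_lt hy)⟩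
  mem_of_locally_approx ξ hξ t ε hε := by
    obtain ⟨ξ', hξ', h⟩ := hξ t (ε / 2) (half_pos hε)
    obtain ⟨ξ'', hξ'', h'⟩ := hξ' t (ε / 2) (half_pos hε)
    refine ⟨ξ'', hξ'', ?_⟩
    filter_upwards [h, h'] with τ hτ hτ'
    rw [← sub_add_sub_cancel _ (ξ' τ)]
    exact (norm_add_le _ _).trans_lt (by linarith)

end Generated

end ContinuousHilbertField

/-- Coefficients of a family of isometries are continuous for locally uniform limits of sections,
if they are so for the sections themselves. -/
theorem continuous_coeff_of_mem_localClosure {X T : Type*} [TopologicalSpace X]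
    [TopologicalSpace T] {fiber : T → Type v} [∀ t, NormedAddCommGroup (fiber t)]
    [∀ t, InnerProductSpace ℂ (fiber t)] {S : Submodule ℂ (∀ t, fiber t)}
    (hS : ∀ ξ ∈ S, Continuous fun t => ‖ξ t‖) {s r : X → T} (hs : Continuous s)
    (hr : Continuous r) (U : ∀ x, fiber (s x) ≃ₗᵢ[ℂ] fiber (r x))
    (hU : ∀ ξ ∈ S, ∀ η ∈ S, Continuous fun x => inner ℂ (η (r x)) (U x (ξ (s x))))
    {ξ η : ∀ t, fiber t} (hξ : ξ ∈ ContinuousHilbertField.localClosure S)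
    (hη : η ∈ ContinuousHilbertField.localClosure S) :
    Continuous fun x => inner ℂ (η (r x)) (U x (ξ (s x))) := by
  refine continuous_iff_continuousAt.2 fun x =>
    continuousAt_of_locally_uniform_approx_of_continuousAt fun V hV => ?_
  obtain ⟨ε, hε, hεV⟩ := Metric.mem_uniformity_dist.1 hV
  -- Near `x` the approximants `ξ'`, `η'` will have norm below `M - 1`, hence `ξ` itself norm below
  -- `M`, as `δ ≤ 1`. The two error terms are each below `δ * M`, and `2 * δ * M ≤ ε`.
  set M : ℝ := ‖ξ (s x)‖ + ‖η (r x)‖ + 3 with hM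
  have hMpos : 0 < M := by positivity
  set δ : ℝ := min 1 (ε / (2 * M)) with hδ
  have hδ0 : 0 < δ := lt_min one_pos (by positivity)
  have hδ1 : δ ≤ 1 := min_le_left _ _
  have hδM : 2 * (δ * M) ≤ ε := by
    have h := min_le_right (1 : ℝ) (ε / (2 * M))
    rw [← hδ, le_div_iff₀ (by positivity)] at h
    linarith
  obtain ⟨ξ', hξ', h1⟩ := hξ (s x) δ hδ0
  obtain ⟨η', hη', h2⟩ := hη (r x) δ hδ0
  -- Norm continuity is assumed for members of `S` only, so the local bound on `ξ` goes through
  -- `ξ'`.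
  have h3 : ∀ᶠ y in 𝓝 x, ‖ξ' (s y)‖ < M - 1 := by
    refine ((hS ξ' hξ').comp hs).continuousAt.eventually_lt continuousAt_const ?_
    have := norm_sub_norm_le (ξ' (s x)) (ξ (s x))
    rw [norm_sub_rev] at this
    have h4 := h1.self_of_nhds
    have h5 := norm_nonneg (η (r x))
    simp only [Function.comp_apply]
    linarith
  have h4 : ∀ᶠ y in 𝓝 x, ‖η' (r y)‖ < M - 1 := by
    refine ((hS η' hη').comp hr).continuousAt.eventually_lt continuousAt_const ?_
    have := norm_sub_norm_le (η' (r x)) (η (r x))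
    rw [norm_sub_rev] at this
    have h4 := h2.self_of_nhds
    have h5 := norm_nonneg (ξ (s x))
    simp only [Function.comp_apply]
    linarith
  refine ⟨_, ((hs.tendsto x).eventually h1).and (((hr.tendsto x).eventually h2).and
    (h3.and h4)), _, (hU ξ' hξ' η' hη').continuousAt, fun y hy => hεV ?_⟩
  obtain ⟨a1, a2, a3, a4⟩ := hy
  have a5 : ‖ξ (s y)‖ < M := by
    have := norm_sub_norm_le (ξ (s y)) (ξ' (s y))
    linarith
  have e : inner ℂ (η (r y)) (U y (ξ (s y))) - inner ℂ (η' (r y)) (U y (ξ' (s y)))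
      = inner ℂ (η (r y) - η' (r y)) (U y (ξ (s y)))
        + inner ℂ (η' (r y)) (U y (ξ (s y) - ξ' (s y))) := by
    rw [map_sub, inner_sub_left, inner_sub_right]; ring
  rw [dist_eq_norm, e]
  have b1 := norm_inner_le_norm (𝕜 := ℂ) (η (r y) - η' (r y)) (U y (ξ (s y)))
  have b2 := norm_inner_le_norm (𝕜 := ℂ) (η' (r y)) (U y (ξ (s y) - ξ' (s y)))
  rw [LinearIsometryEquiv.norm_map] at b1 b2
  have c1 : ‖η (r y) - η' (r y)‖ * ‖ξ (s y)‖ < δ * M :=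
    mul_lt_mul'' a2 a5 (norm_nonneg _) (norm_nonneg _)
  have c2 : ‖η' (r y)‖ * ‖ξ (s y) - ξ' (s y)‖ < M * δ :=
    mul_lt_mul'' (by linarith) a1 (norm_nonneg _) (norm_nonneg _)
  refine (norm_add_le _ _).trans_lt ?_
  linarith

/-! ### Hilbert tensor products -/

section HilbertTensor

open UniformSpace

/-- The isometry of completions induced by an isometry. -/
noncomputable def completionCongr {E F : Type*} [NormedAddCommGroup E] [InnerProductSpace ℂ E]
    [NormedAddCommGroup F] [InnerProductSpace ℂ F] (f : E ≃ₗᵢ[ℂ] F) :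
    Completion E ≃ₗᵢ[ℂ] Completion F :=
  f.toLinearEquiv.extendOfIsometry
    (Completion.toComplₗᵢ (𝕜 := ℂ) (E := E)).toLinearMap
    (Completion.toComplₗᵢ (𝕜 := ℂ) (E := F)).toLinearMap
    Completion.denseRange_coe Completion.denseRange_coe fun x => by simp

theorem completionCongr_coe {E F : Type*} [NormedAddCommGroup E] [InnerProductSpace ℂ E]
    [NormedAddCommGroup F] [InnerProductSpace ℂ F] (f : E ≃ₗᵢ[ℂ] F) (x : E) :
    completionCongr f (x : Completion E) = (f x : Completion F) :=
  LinearEquiv.extendOfIsometry_eq f.toLinearEquiv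
    (Completion.toComplₗᵢ (𝕜 := ℂ) (E := E)).toLinearMap
    (Completion.toComplₗᵢ (𝕜 := ℂ) (E := F)).toLinearMap
    Completion.denseRange_coe Completion.denseRange_coe (fun x => by simp) x

theorem completionCongr_trans {E F K : Type*} [NormedAddCommGroup E] [InnerProductSpace ℂ E]
    [NormedAddCommGroup F] [InnerProductSpace ℂ F] [NormedAddCommGroup K] [InnerProductSpace ℂ K]
    (f : E ≃ₗᵢ[ℂ] F) (g : F ≃ₗᵢ[ℂ] K) (x : Completion E) :
    completionCongr (f.trans g) x = completionCongr g (completionCongr f x) := by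
  induction x using Completion.induction_on with
  | hp =>
    exact isClosed_eq (LinearIsometryEquiv.continuous _)
      ((LinearIsometryEquiv.continuous (completionCongr g)).comp
        (LinearIsometryEquiv.continuous (completionCongr f)))
  | ih x => simp only [completionCongr_coe, LinearIsometryEquiv.trans_apply]

variable {E₁ E₂ F₁ F₂ K₁ K₂ : Type*} [NormedAddCommGroup E₁]
    [InnerProductSpace ℂ E₁] [NormedAddCommGroup E₂] [InnerProductSpace ℂ E₂]
    [NormedAddCommGroup F₁] [InnerProductSpace ℂ F₁] [NormedAddCommGroup F₂]
    [InnerProductSpace ℂ F₂] [NormedAddCommGroup K₁]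
    [InnerProductSpace ℂ K₁] [NormedAddCommGroup K₂] [InnerProductSpace ℂ K₂]

/-- The Hilbert space tensor product. -/
abbrev HilbertTensor (E₁ E₂ : Type*) [NormedAddCommGroup E₁]
    [InnerProductSpace ℂ E₁] [NormedAddCommGroup E₂] [InnerProductSpace ℂ E₂] :=
  Completion (TensorProduct ℂ E₁ E₂)

/-- The elementary tensor of two vectors in the Hilbert space tensor product. -/
noncomputable def htmul (a : E₁) (b : E₂) : HilbertTensor E₁ E₂ :=
  ((TensorProduct.tmul ℂ a b : TensorProduct ℂ E₁ E₂) : Completion (TensorProduct ℂ E₁ E₂))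

theorem inner_htmul (a a' : E₁) (b b' : E₂) :
    inner ℂ (htmul a b) (htmul a' b') = inner ℂ a a' * inner ℂ b b' := by
  rw [htmul, htmul, Completion.inner_coe, TensorProduct.inner_tmul]

theorem norm_htmul (a : E₁) (b : E₂) : ‖htmul a b‖ = ‖a‖ * ‖b‖ := by
  rw [htmul, Completion.norm_coe, TensorProduct.norm_tmul]

theorem continuous_htmul : Continuous fun p : E₁ × E₂ => htmul p.1 p.2 :=
  (Completion.continuous_coe _).comp TensorProduct.continuous_tmul

/-- The closure of `P` is a subspace, so it contains finite sums of elementary tensors, that is, the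
algebraic tensor product, which is dense in its completion. -/
theorem dense_of_htmul_mem_closure {P : Submodule ℂ (HilbertTensor E₁ E₂)}
    (h : ∀ (a : E₁) (b : E₂), htmul a b ∈ P.topologicalClosure) :
    Dense (P : Set (HilbertTensor E₁ E₂)) := by
  have hcoe : ∀ z : TensorProduct ℂ E₁ E₂,
      (z : Completion (TensorProduct ℂ E₁ E₂)) ∈ P.topologicalClosure := by
    intro z
    induction z with
    | zero => exact P.topologicalClosure.zero_mem
    | tmul a b => exact h a b
    | add a b ha hb => rw [Completion.coe_add]; exact P.topologicalClosure.add_mem ha hb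
  refine dense_closure.1 (Completion.denseRange_coe.mono ?_)
  rintro _ ⟨z, rfl⟩
  exact hcoe z

/-- The isometry of Hilbert space tensor products induced by a pair of isometries. -/
noncomputable def tensorCongr (f : E₁ ≃ₗᵢ[ℂ] F₁) (g : E₂ ≃ₗᵢ[ℂ] F₂) :
    HilbertTensor E₁ E₂ ≃ₗᵢ[ℂ] HilbertTensor F₁ F₂ :=
  completionCongr (TensorProduct.congrIsometry f g)

theorem tensorCongr_htmul (f : E₁ ≃ₗᵢ[ℂ] F₁) (g : E₂ ≃ₗᵢ[ℂ] F₂) (a : E₁) (b : E₂) :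
    tensorCongr f g (htmul a b) = htmul (f a) (g b) :=
  completionCongr_coe (TensorProduct.congrIsometry f g) _

theorem tensorCongr_trans (f : E₁ ≃ₗᵢ[ℂ] F₁) (g : E₂ ≃ₗᵢ[ℂ] F₂) (f' : F₁ ≃ₗᵢ[ℂ] K₁)
    (g' : F₂ ≃ₗᵢ[ℂ] K₂) (x : HilbertTensor E₁ E₂) :
    tensorCongr (f.trans f') (g.trans g') x = tensorCongr f' g' (tensorCongr f g x) := by
  have h : TensorProduct.congrIsometry (f.trans f') (g.trans g')
      = (TensorProduct.congrIsometry f g).trans (TensorProduct.congrIsometry f' g') := by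
    ext x
    induction x with
    | zero => simp
    | tmul a b => rfl
    | add a b ha hb => rw [map_add, map_add, ha, hb]
  rw [tensorCongr, h]
  exact completionCongr_trans _ _ x

end HilbertTensor

/-- Coefficients of a family of isometries are continuous on the span of a set of sections on
which they are continuous. -/
theorem continuous_coeff_of_mem_span {X T : Type*} [TopologicalSpace X]
    {fiber : T → Type v} [∀ t, NormedAddCommGroup (fiber t)]
    [∀ t, InnerProductSpace ℂ (fiber t)] {A : Set (∀ t, fiber t)} {s r : X → T}
    (U : ∀ x, fiber (s x) ≃ₗᵢ[ℂ] fiber (r x))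
    (hU : ∀ ξ ∈ A, ∀ η ∈ A, Continuous fun x => inner ℂ (η (r x)) (U x (ξ (s x))))
    {ξ η : ∀ t, fiber t} (hξ : ξ ∈ Submodule.span ℂ A) (hη : η ∈ Submodule.span ℂ A) :
    Continuous fun x => inner ℂ (η (r x)) (U x (ξ (s x))) := by
  induction hξ, hη using Submodule.span_induction₂ with
  | mem_mem ξ η hξ hη => exact hU ξ hξ η hη
  | zero_left => simpa using continuous_const
  | zero_right => simpa using continuous_const
  | add_left _ _ _ _ _ _ h h' =>
    exact (h.add h').congr fun x => by rw [Pi.add_apply, Pi.add_apply, map_add, inner_add_right]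
  | add_right _ _ _ _ _ _ h h' =>
    exact (h.add h').congr fun x => by rw [Pi.add_apply, Pi.add_apply, inner_add_left]
  | smul_left c _ _ _ _ h =>
    exact (h.const_mul c).congr fun x => by rw [Pi.smul_apply, map_smul, inner_smul_right]
  | smul_right c _ _ _ _ h =>
    exact (h.const_mul ((starRingEnd ℂ) c)).congr fun x => by rw [Pi.smul_apply, inner_smul_left]

/-! ### Tensor products of fields, and sections of tensor products and direct sums. -/

namespace ContinuousHilbertField

open UniformSpace

variable {T : Type u} [TopologicalSpace T] (H₁ H₂ : ContinuousHilbertField.{u, v} T)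

/-- The section `t ↦ ξ(t) ⊗ η(t)` of the completed tensor products of the fibres. -/
noncomputable def tmulSection (ξ : ∀ t, H₁.fiber t) (η : ∀ t, H₂.fiber t) (t : T) :
    HilbertTensor (H₁.fiber t) (H₂.fiber t) :=
  htmul (ξ t) (η t)

/-- The elementary tensors of bounded sections. -/
def elementaryTensors :
    Set (∀ t, HilbertTensor (H₁.fiber t) (H₂.fiber t)) :=
  {ζ | ∃ ξ ∈ H₁.boundedSections, ∃ η ∈ H₂.boundedSections, ζ = tmulSection H₁ H₂ ξ η}

theorem norm_tmulSection (ξ : ∀ t, H₁.fiber t) (η : ∀ t, H₂.fiber t) (t : T) :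
    ‖tmulSection H₁ H₂ ξ η t‖ = ‖ξ t‖ * ‖η t‖ :=
  norm_htmul _ _

theorem continuous_norm_of_mem_span_elementaryTensors
    {ζ : ∀ t, HilbertTensor (H₁.fiber t) (H₂.fiber t)}
    (hζ : ζ ∈ Submodule.span ℂ (elementaryTensors H₁ H₂)) : Continuous fun t => ‖ζ t‖ := by
  have h : Continuous fun t => inner ℂ (ζ t) (ζ t) := by
    -- The squared norm is a coefficient of the family of identity maps, so sesquilinearity reduces
    -- to elementary tensors, where the inner product factors.
    refine continuous_coeff_of_mem_span (X := T) (s := id) (r := id)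
      (fun t => LinearIsometryEquiv.refl ℂ _) ?_ hζ hζ
    rintro _ ⟨ξ, hξ, η, hη, rfl⟩ _ ⟨ξ', hξ', η', hη', rfl⟩
    simp only [tmulSection, id, LinearIsometryEquiv.coe_refl, inner_htmul]
    exact (H₁.continuous_inner_sections hξ'.1 hξ.1).mul (H₂.continuous_inner_sections hη'.1 hη.1)
  simp_rw [norm_eq_sqrt_re_inner (𝕜 := ℂ)]
  exact (Complex.continuous_re.comp h).sqrt

/-- Values of bounded sections are dense in each factor and `htmul` is jointly continuous, so every
elementary tensor is a limit of values of elementary sections. -/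
theorem dense_eval_span_elementaryTensors (t : T) :
    Dense {w | ∃ ζ ∈ Submodule.span ℂ (elementaryTensors H₁ H₂), ζ t = w} := by
  set P : Submodule ℂ (HilbertTensor (H₁.fiber t) (H₂.fiber t)) :=
    (Submodule.span ℂ (elementaryTensors H₁ H₂)).map (LinearMap.proj t) with hP
  change Dense (P : Set (HilbertTensor (H₁.fiber t) (H₂.fiber t)))
  refine dense_of_htmul_mem_closure fun a b => ?_
  have hd := (H₁.dense_eval_boundedSections t).prod (H₂.dense_eval_boundedSections t)
  refine map_mem_closure (f := fun p : H₁.fiber t × H₂.fiber t => htmul p.1 p.2)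
    continuous_htmul (hd (a, b)) ?_
  rintro ⟨_, _⟩ ⟨⟨ξ, hξ, rfl⟩, ⟨η, hη, rfl⟩⟩
  exact ⟨tmulSection H₁ H₂ ξ η, Submodule.subset_span ⟨ξ, hξ, η, hη, rfl⟩, rfl⟩

/-- The tensor product of two continuous Hilbert fields. -/
noncomputable def tensor : ContinuousHilbertField.{u, v} T :=
  generated (Submodule.span ℂ (elementaryTensors H₁ H₂))
    (dense_eval_span_elementaryTensors H₁ H₂)
    fun _ hζ => continuous_norm_of_mem_span_elementaryTensors H₁ H₂ hζ

variable {H₁ H₂}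

theorem tmulSection_mem_boundedSections {ξ : ∀ t, H₁.fiber t} {η : ∀ t, H₂.fiber t}
    (hξ : ξ ∈ H₁.boundedSections) (hη : η ∈ H₂.boundedSections) :
    tmulSection H₁ H₂ ξ η ∈ (tensor H₁ H₂).boundedSections := by
  refine ⟨le_localClosure _ (Submodule.subset_span ⟨ξ, hξ, η, hη, rfl⟩),
    H₁.sectionNorm ξ * H₂.sectionNorm η, ?_⟩
  rintro _ ⟨t, rfl⟩
  exact (norm_tmulSection H₁ H₂ ξ η t).trans_le (mul_le_mul (H₁.norm_le_sectionNorm hξ t)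
    (H₂.norm_le_sectionNorm hη t) (norm_nonneg _) (H₁.sectionNorm_nonneg ξ))

theorem sectionNorm_tmulSection_le {ξ : ∀ t, H₁.fiber t} {η : ∀ t, H₂.fiber t}
    (hξ : ξ ∈ H₁.boundedSections) (hη : η ∈ H₂.boundedSections) :
    (tensor H₁ H₂).sectionNorm (tmulSection H₁ H₂ ξ η) ≤ H₁.sectionNorm ξ * H₂.sectionNorm η :=
  sectionNorm_le _ (mul_nonneg (H₁.sectionNorm_nonneg ξ) (H₂.sectionNorm_nonneg η)) fun t =>
    (norm_tmulSection H₁ H₂ ξ η t).trans_le (mul_le_mul (H₁.norm_le_sectionNorm hξ t)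
      (H₂.norm_le_sectionNorm hη t) (norm_nonneg _) (H₁.sectionNorm_nonneg ξ))

/-- The section `t ↦ (ξ(t), η(t))` of a direct sum. -/
def pairSection (ξ : ∀ t, H₁.fiber t) (η : ∀ t, H₂.fiber t) (t : T) :
    (directSum H₁ H₂).fiber t :=
  WithLp.toLp 2 (ξ t, η t)

theorem norm_pairSection_le {ξ : ∀ t, H₁.fiber t} {η : ∀ t, H₂.fiber t}
    (hξ : ξ ∈ H₁.boundedSections) (hη : η ∈ H₂.boundedSections) (t : T) :
    ‖pairSection ξ η t‖ ≤ √(H₁.sectionNorm ξ ^ 2 + H₂.sectionNorm η ^ 2) :=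
  (WithLp.prod_norm_eq_of_L2 (α := H₁.fiber t) (β := H₂.fiber t) _).trans_le <|
    Real.sqrt_le_sqrt <| add_le_add
      (pow_le_pow_left₀ (norm_nonneg _) (H₁.norm_le_sectionNorm hξ t) 2)
      (pow_le_pow_left₀ (norm_nonneg _) (H₂.norm_le_sectionNorm hη t) 2)

theorem pairSection_mem_boundedSections {ξ : ∀ t, H₁.fiber t} {η : ∀ t, H₂.fiber t}
    (hξ : ξ ∈ H₁.boundedSections) (hη : η ∈ H₂.boundedSections) :
    pairSection ξ η ∈ (directSum H₁ H₂).boundedSections := by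
  refine ⟨⟨hξ.1, hη.1⟩, √(H₁.sectionNorm ξ ^ 2 + H₂.sectionNorm η ^ 2), ?_⟩
  rintro _ ⟨t, rfl⟩
  exact norm_pairSection_le hξ hη t

theorem sectionNorm_pairSection_le {ξ : ∀ t, H₁.fiber t} {η : ∀ t, H₂.fiber t}
    (hξ : ξ ∈ H₁.boundedSections) (hη : η ∈ H₂.boundedSections) :
    (directSum H₁ H₂).sectionNorm (pairSection ξ η)
      ≤ √(H₁.sectionNorm ξ ^ 2 + H₂.sectionNorm η ^ 2) :=
  sectionNorm_le _ (Real.sqrt_nonneg _) (norm_pairSection_le hξ hη)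

end ContinuousHilbertField

/-! ### Constructions of groupoid representations -/

namespace GroupoidRep

open ContinuousHilbertField

variable {G : Type u} [AlgGroupoid G] [TopologicalSpace G]

/-- The trivial representation on a constant field. -/
def trivial (G : Type u) [AlgGroupoid G] [TopologicalSpace G] [TopologicalGroupoid G] (E : Type v)
    [NormedAddCommGroup E] [InnerProductSpace ℂ E] [CompleteSpace E] :
    GroupoidRep G (ContinuousHilbertField.const (unitSpace G) E) where
  map _ := LinearIsometryEquiv.refl ℂ E
  continuous_coeff ξ hξ η hη := by
    have hξ' : Continuous (ξ : unitSpace G → E) := hξ.1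
    have hη' : Continuous (η : unitSpace G → E) := hη.1
    exact (hη'.comp continuous_rng).inner (hξ'.comp continuous_src)
  map_comp _ _ _ := rfl

variable {H₁ H₂ : ContinuousHilbertField.{u, v} (unitSpace G)}

/-- The direct sum of two representations. -/
noncomputable def directSum (ϖ₁ : GroupoidRep G H₁) (ϖ₂ : GroupoidRep G H₂) :
    GroupoidRep G (H₁.directSum H₂) where
  map x := LinearIsometryEquiv.withLpProdCongr 2 (ϖ₁.map x) (ϖ₂.map x)
  continuous_coeff ξ hξ η hη := by
    have bdd : ∀ {ζ}, ζ ∈ (H₁.directSum H₂).boundedSections →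
        (fun t => (ζ t).fst) ∈ H₁.boundedSections ∧
          (fun t => (ζ t).snd) ∈ H₂.boundedSections := by
      rintro ζ ⟨hζ, a, ha⟩
      refine ⟨⟨hζ.1, a, ?_⟩, ⟨hζ.2, a, ?_⟩⟩
      · rintro _ ⟨t, rfl⟩
        exact (WithLp.norm_fst_le _ (ζ t)).trans (ha ⟨t, rfl⟩)
      · rintro _ ⟨t, rfl⟩
        exact (WithLp.norm_snd_le _ (ζ t)).trans (ha ⟨t, rfl⟩)
    exact (ϖ₁.continuous_coeff _ (bdd hξ).1 _ (bdd hη).1).add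
      (ϖ₂.continuous_coeff _ (bdd hξ).2 _ (bdd hη).2)
  map_comp x y v := by
    refine WithLp.ofLp_injective 2 (Prod.ext ?_ ?_)
    · exact ϖ₁.map_comp x y _
    · exact ϖ₂.map_comp x y _

/-- The inner product of the orthogonal sum is the sum of the inner products; this closes `B(𝒢)`
under addition. -/
theorem coeff_directSum (ϖ₁ : GroupoidRep G H₁) (ϖ₂ : GroupoidRep G H₂)
    (ξ₁ η₁ : ∀ t, H₁.fiber t) (ξ₂ η₂ : ∀ t, H₂.fiber t) :
    (ϖ₁.directSum ϖ₂).coeff (pairSection ξ₁ ξ₂) (pairSection η₁ η₂)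
      = ϖ₁.coeff ξ₁ η₁ + ϖ₂.coeff ξ₂ η₂ :=
  rfl

/-- A representation on a generated field, given by its isometries on the fibres. -/
def generated [TopologicalGroupoid G] {fiber : unitSpace G → Type v}
    [∀ t, NormedAddCommGroup (fiber t)] [∀ t, InnerProductSpace ℂ (fiber t)]
    [∀ t, CompleteSpace (fiber t)] (S : Submodule ℂ (∀ t, fiber t))
    (hd : ∀ t, Dense {w : fiber t | ∃ ξ ∈ S, ξ t = w})
    (hc : ∀ ξ ∈ S, Continuous fun t => ‖ξ t‖)
    (U : ∀ {a b : unitSpace G}, Arrow a b → (fiber a ≃ₗᵢ[ℂ] fiber b))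
    (hU : ∀ {a b c : unitSpace G} (x : Arrow b c) (y : Arrow a b),
      U (x.comp y) = (U y).trans (U x))
    (hUc : ∀ ξ ∈ S, ∀ η ∈ S,
      Continuous fun x : G => inner ℂ (η (rng x)) (U (toArrow x) (ξ (src x)))) :
    GroupoidRep G (ContinuousHilbertField.generated S hd hc) where
  map x := U x
  continuous_coeff _ hξ _ hη :=
    continuous_coeff_of_mem_localClosure hc continuous_src continuous_rng
      (fun x => U (toArrow x)) hUc hξ.1 hη.1
  map_comp x y w := congrArg (fun V => V w) (hU x y)

theorem tensorCongr_map_comp (ϖ₁ : GroupoidRep G H₁) (ϖ₂ : GroupoidRep G H₂)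
    {a b c : unitSpace G} (x : Arrow b c) (y : Arrow a b) :
    tensorCongr (ϖ₁.map (x.comp y)) (ϖ₂.map (x.comp y))
      = (tensorCongr (ϖ₁.map y) (ϖ₂.map y)).trans (tensorCongr (ϖ₁.map x) (ϖ₂.map x)) := by
  have h₁ : ϖ₁.map (x.comp y) = (ϖ₁.map y).trans (ϖ₁.map x) :=
    LinearIsometryEquiv.ext (ϖ₁.map_comp x y)
  have h₂ : ϖ₂.map (x.comp y) = (ϖ₂.map y).trans (ϖ₂.map x) :=
    LinearIsometryEquiv.ext (ϖ₂.map_comp x y)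
  rw [h₁, h₂]
  exact LinearIsometryEquiv.ext (tensorCongr_trans _ _ _ _)

theorem inner_tmulSection (ϖ₁ : GroupoidRep G H₁) (ϖ₂ : GroupoidRep G H₂)
    (ξ₁ η₁ : ∀ t, H₁.fiber t) (ξ₂ η₂ : ∀ t, H₂.fiber t) (x : G) :
    inner ℂ (tmulSection H₁ H₂ η₁ η₂ (rng x)) (tensorCongr (ϖ₁.map (toArrow x))
      (ϖ₂.map (toArrow x)) (tmulSection H₁ H₂ ξ₁ ξ₂ (src x)))
      = ϖ₁.coeff ξ₁ η₁ x * ϖ₂.coeff ξ₂ η₂ x := by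
  rw [tmulSection, tmulSection, tensorCongr_htmul, inner_htmul]
  rfl

/-- On elementary tensors the coefficient is a product of two coefficients of bounded sections.
Continuity is available for bounded sections only, which is why the tensor field is generated by
them. -/
theorem continuous_coeff_span_elementaryTensors (ϖ₁ : GroupoidRep G H₁) (ϖ₂ : GroupoidRep G H₂)
    {ξ η : ∀ t, HilbertTensor (H₁.fiber t) (H₂.fiber t)}
    (hξ : ξ ∈ Submodule.span ℂ (elementaryTensors H₁ H₂))
    (hη : η ∈ Submodule.span ℂ (elementaryTensors H₁ H₂)) :
    Continuous fun x : G => inner ℂ (η (rng x))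
      (tensorCongr (ϖ₁.map (toArrow x)) (ϖ₂.map (toArrow x)) (ξ (src x))) := by
  refine continuous_coeff_of_mem_span (fiber := fun t => HilbertTensor (H₁.fiber t) (H₂.fiber t))
    (s := src) (r := rng)
    (fun x : G => tensorCongr (ϖ₁.map (toArrow x)) (ϖ₂.map (toArrow x))) ?_ hξ hη
  rintro _ ⟨ξ₁, hξ₁, ξ₂, hξ₂, rfl⟩ _ ⟨η₁, hη₁, η₂, hη₂, rfl⟩
  simp only [inner_tmulSection]
  exact (ϖ₁.continuous_coeff _ hξ₁ _ hη₁).mul (ϖ₂.continuous_coeff _ hξ₂ _ hη₂)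

/-- The tensor product of two representations. -/
noncomputable def tensor [TopologicalGroupoid G] (ϖ₁ : GroupoidRep G H₁)
    (ϖ₂ : GroupoidRep G H₂) : GroupoidRep G (H₁.tensor H₂) :=
  generated (Submodule.span ℂ (elementaryTensors H₁ H₂))
    (dense_eval_span_elementaryTensors H₁ H₂)
    (fun _ hζ => continuous_norm_of_mem_span_elementaryTensors H₁ H₂ hζ)
    (fun x => tensorCongr (ϖ₁.map x) (ϖ₂.map x)) (tensorCongr_map_comp ϖ₁ ϖ₂)
    fun _ h _ h' => continuous_coeff_span_elementaryTensors ϖ₁ ϖ₂ h h'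

theorem coeff_tensor [TopologicalGroupoid G] (ϖ₁ : GroupoidRep G H₁) (ϖ₂ : GroupoidRep G H₂)
    (ξ₁ η₁ : ∀ t, H₁.fiber t) (ξ₂ η₂ : ∀ t, H₂.fiber t) :
    (ϖ₁.tensor ϖ₂).coeff (tmulSection H₁ H₂ ξ₁ ξ₂) (tmulSection H₁ H₂ η₁ η₂)
      = ϖ₁.coeff ξ₁ η₁ * ϖ₂.coeff ξ₂ η₂ :=
  funext fun x => inner_tmulSection ϖ₁ ϖ₂ ξ₁ η₁ ξ₂ η₂ x

theorem coeff_smul_left (ϖ : GroupoidRep G H₁) (c : ℂ) (ξ η : ∀ t, H₁.fiber t) :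
    ϖ.coeff (c • ξ) η = c • ϖ.coeff ξ η := by
  funext x
  simp [coeff]

theorem coeff_smul_right (ϖ : GroupoidRep G H₁) (c : ℂ) (ξ η : ∀ t, H₁.fiber t) :
    ϖ.coeff ξ (c • η) = (starRingEnd ℂ) c • ϖ.coeff ξ η := by
  funext x
  simp [coeff, mul_comm]

end GroupoidRep

/-! ### The Fourier–Stieltjes algebra of a groupoid -/

section FourierStieltjes

variable {G : Type u} [AlgGroupoid G] [TopologicalSpace G]

theorem fsNorm_nonneg (φ : G → ℂ) : 0 ≤ fsNorm φ := by
  refine Real.sInf_nonneg ?_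
  rintro _ ⟨H, ϖ, ξ, -, η, -, -, rfl⟩
  exact mul_nonneg (H.sectionNorm_nonneg ξ) (H.sectionNorm_nonneg η)

theorem fsNorm_coeff_le {H : ContinuousHilbertField.{u, u} (unitSpace G)} (ϖ : GroupoidRep G H)
    {ξ η : ∀ t, H.fiber t} (hξ : ξ ∈ H.boundedSections) (hη : η ∈ H.boundedSections) :
    fsNorm (ϖ.coeff ξ η) ≤ H.sectionNorm ξ * H.sectionNorm η := by
  refine csInf_le ⟨0, ?_⟩ ⟨H, ϖ, ξ, hξ, η, hη, rfl, rfl⟩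
  rintro _ ⟨H, ϖ, ξ, -, η, -, -, rfl⟩
  exact mul_nonneg (H.sectionNorm_nonneg ξ) (H.sectionNorm_nonneg η)

/-- Membership in `B(𝒢)` makes the set under the infimum nonempty; otherwise `sInf` would take its
default value 0. -/
theorem exists_coeff_of_fsNorm_lt {φ : G → ℂ} (hφ : φ ∈ fourierStieltjes G) {c : ℝ}
    (hc : fsNorm φ < c) :
    ∃ (H : ContinuousHilbertField.{u, u} (unitSpace G)) (ϖ : GroupoidRep G H),
      ∃ ξ ∈ H.boundedSections, ∃ η ∈ H.boundedSections,
        φ = ϖ.coeff ξ η ∧ H.sectionNorm ξ * H.sectionNorm η < c := by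
  obtain ⟨H, ϖ, ξ, hξ, η, hη, h⟩ := hφ
  obtain ⟨_, ⟨H', ϖ', ξ', hξ', η', hη', h', rfl⟩, hlt⟩ :=
    exists_lt_of_csInf_lt (by exact ⟨_, H, ϖ, ξ, hξ, η, hη, h, rfl⟩) hc
  exact ⟨H', ϖ', ξ', hξ', η', hη', h', hlt⟩

theorem exists_scaling_le_sqrt {a b c : ℝ} (ha : 0 ≤ a) (hb : 0 ≤ b) (h : a * b < c) :
    ∃ t : ℝ, 0 < t ∧ t * a ≤ √c ∧ t⁻¹ * b ≤ √c := by
  have hc : 0 < c := (mul_nonneg ha hb).trans_lt h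
  have hs : 0 < √c := Real.sqrt_pos.2 hc
  rcases ha.eq_or_lt with rfl | ha
  -- When `a = 0`, any positive `t ≥ b / √c` serves; adding 1 keeps `t` positive if `b = 0`.
  · refine ⟨b / √c + 1, by positivity, by simp, ?_⟩
    rw [inv_mul_le_iff₀ (by positivity), add_mul, div_mul_cancel₀ _ hs.ne']
    linarith
  · refine ⟨√c / a, by positivity, (div_mul_cancel₀ _ ha.ne').le, ?_⟩
    rw [inv_div, div_mul_eq_mul_div, div_le_iff₀ hs, Real.mul_self_sqrt hc.le]
    exact h.le

/-- A coefficient of norm less than `c` is a coefficient of sections of norm at most `√c`. -/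
theorem exists_balanced_coeff {φ : G → ℂ} (hφ : φ ∈ fourierStieltjes G) {c : ℝ}
    (hc : fsNorm φ < c) :
    ∃ (H : ContinuousHilbertField.{u, u} (unitSpace G)) (ϖ : GroupoidRep G H),
      ∃ ξ ∈ H.boundedSections, ∃ η ∈ H.boundedSections,
        φ = ϖ.coeff ξ η ∧ H.sectionNorm ξ ≤ √c ∧ H.sectionNorm η ≤ √c := by
  obtain ⟨H, ϖ, ξ, hξ, η, hη, rfl, hlt⟩ := exists_coeff_of_fsNorm_lt hφ hc
  obtain ⟨t, ht, h1, h2⟩ := exists_scaling_le_sqrt (H.sectionNorm_nonneg ξ)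
    (H.sectionNorm_nonneg η) hlt
  have htn : ‖(t : ℂ)‖ = t := by rw [Complex.norm_real, Real.norm_of_nonneg ht.le]
  -- The factors cancel in the coefficient because `t` is real, hence fixed by conjugation.
  refine ⟨H, ϖ, (t : ℂ) • ξ, H.boundedSubmodule.smul_mem _ hξ, (t : ℂ)⁻¹ • η,
    H.boundedSubmodule.smul_mem _ hη, ?_, ?_, ?_⟩
  · rw [ϖ.coeff_smul_left, ϖ.coeff_smul_right, smul_smul, map_inv₀, Complex.conj_ofReal,
      mul_inv_cancel₀ (Complex.ofReal_ne_zero.2 ht.ne'), one_smul]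
  · refine (H.sectionNorm_smul_le hξ _).trans ?_
    rwa [htn]
  · refine (H.sectionNorm_smul_le hη _).trans ?_
    rwa [norm_inv, htn]

theorem add_mem_fourierStieltjes {φ ψ : G → ℂ} (hφ : φ ∈ fourierStieltjes G)
    (hψ : ψ ∈ fourierStieltjes G) : φ + ψ ∈ fourierStieltjes G := by
  obtain ⟨H₁, ϖ₁, ξ₁, hξ₁, η₁, hη₁, rfl⟩ := hφ
  obtain ⟨H₂, ϖ₂, ξ₂, hξ₂, η₂, hη₂, rfl⟩ := hψ
  exact ⟨_, ϖ₁.directSum ϖ₂, _, ContinuousHilbertField.pairSection_mem_boundedSections hξ₁ hξ₂, _,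
    ContinuousHilbertField.pairSection_mem_boundedSections hη₁ hη₂,
    (ϖ₁.coeff_directSum ϖ₂ ξ₁ η₁ ξ₂ η₂).symm⟩

/-- Balancing is essential: with both sections for `φ` of norm at most `√c` and both for `ψ` at most
`√d`, each paired section has norm at most `√(c + d)`, and the product of the two bounds is exactly
`c + d`. -/
theorem fsNorm_add_le {φ ψ : G → ℂ} (hφ : φ ∈ fourierStieltjes G)
    (hψ : ψ ∈ fourierStieltjes G) : fsNorm (φ + ψ) ≤ fsNorm φ + fsNorm ψ := by
  refine le_add_of_forall_lt fun c hc d hd => ?_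
  obtain ⟨H₁, ϖ₁, ξ₁, hξ₁, η₁, hη₁, rfl, a1, b1⟩ := exists_balanced_coeff hφ hc
  obtain ⟨H₂, ϖ₂, ξ₂, hξ₂, η₂, hη₂, rfl, a2, b2⟩ := exists_balanced_coeff hψ hd
  have hc0 : 0 ≤ c := (fsNorm_nonneg _).trans hc.le
  have hd0 : 0 ≤ d := (fsNorm_nonneg _).trans hd.le
  have key : ∀ {ζ₁ : ∀ t, H₁.fiber t} {ζ₂ : ∀ t, H₂.fiber t}, ζ₁ ∈ H₁.boundedSections →
      ζ₂ ∈ H₂.boundedSections → H₁.sectionNorm ζ₁ ≤ √c → H₂.sectionNorm ζ₂ ≤ √d →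
      (H₁.directSum H₂).sectionNorm (ContinuousHilbertField.pairSection ζ₁ ζ₂) ≤ √(c + d) := by
    intro ζ₁ ζ₂ h1 h2 n1 n2
    refine (ContinuousHilbertField.sectionNorm_pairSection_le h1 h2).trans
      (Real.sqrt_le_sqrt (add_le_add ?_ ?_))
    · exact (Real.le_sqrt (H₁.sectionNorm_nonneg _) hc0).1 n1
    · exact (Real.le_sqrt (H₂.sectionNorm_nonneg _) hd0).1 n2
  rw [← ϖ₁.coeff_directSum ϖ₂]
  refine (fsNorm_coeff_le _ (ContinuousHilbertField.pairSection_mem_boundedSections hξ₁ hξ₂)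
    (ContinuousHilbertField.pairSection_mem_boundedSections hη₁ hη₂)).trans ?_
  refine (mul_le_mul (key hξ₁ hξ₂ a1 a2) (key hη₁ hη₂ b1 b2)
    (ContinuousHilbertField.sectionNorm_nonneg _ _) (Real.sqrt_nonneg _)).trans_eq ?_
  exact Real.mul_self_sqrt (add_nonneg hc0 hd0)

theorem smul_mem_fourierStieltjes (c : ℂ) {φ : G → ℂ} (hφ : φ ∈ fourierStieltjes G) :
    c • φ ∈ fourierStieltjes G := by
  obtain ⟨H, ϖ, ξ, hξ, η, hη, rfl⟩ := hφ
  exact ⟨H, ϖ, c • ξ, H.boundedSubmodule.smul_mem c hξ, η, hη, (ϖ.coeff_smul_left c ξ η).symm⟩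

theorem fsNorm_smul_le (c : ℂ) {φ : G → ℂ} (hφ : φ ∈ fourierStieltjes G) :
    fsNorm (c • φ) ≤ ‖c‖ * fsNorm φ := by
  refine le_mul_of_forall_lt₀ fun b hb d hd => ?_
  obtain ⟨H, ϖ, ξ, hξ, η, hη, rfl, h⟩ := exists_coeff_of_fsNorm_lt hφ hd
  rw [← ϖ.coeff_smul_left]
  refine (fsNorm_coeff_le _ (H.boundedSubmodule.smul_mem c hξ) hη).trans ?_
  have h1 := mul_le_mul_of_nonneg_right (H.sectionNorm_smul_le hξ c) (H.sectionNorm_nonneg η)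
  have h2 := mul_le_mul hb.le h.le
    (mul_nonneg (H.sectionNorm_nonneg ξ) (H.sectionNorm_nonneg η)) ((norm_nonneg c).trans hb.le)
  rw [mul_assoc] at h1
  exact h1.trans h2

variable [TopologicalGroupoid G]

theorem mul_mem_fourierStieltjes {φ ψ : G → ℂ} (hφ : φ ∈ fourierStieltjes G)
    (hψ : ψ ∈ fourierStieltjes G) : φ * ψ ∈ fourierStieltjes G := by
  obtain ⟨H₁, ϖ₁, ξ₁, hξ₁, η₁, hη₁, rfl⟩ := hφ
  obtain ⟨H₂, ϖ₂, ξ₂, hξ₂, η₂, hη₂, rfl⟩ := hψ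
  exact ⟨_, ϖ₁.tensor ϖ₂, _, ContinuousHilbertField.tmulSection_mem_boundedSections hξ₁ hξ₂, _,
    ContinuousHilbertField.tmulSection_mem_boundedSections hη₁ hη₂,
    (ϖ₁.coeff_tensor ϖ₂ ξ₁ η₁ ξ₂ η₂).symm⟩

theorem fsNorm_mul_le {φ ψ : G → ℂ} (hφ : φ ∈ fourierStieltjes G)
    (hψ : ψ ∈ fourierStieltjes G) : fsNorm (φ * ψ) ≤ fsNorm φ * fsNorm ψ := by
  refine le_mul_of_forall_lt₀ fun c hc d hd => ?_
  obtain ⟨H₁, ϖ₁, ξ₁, hξ₁, η₁, hη₁, rfl, h1⟩ := exists_coeff_of_fsNorm_lt hφ hc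
  obtain ⟨H₂, ϖ₂, ξ₂, hξ₂, η₂, hη₂, rfl, h2⟩ := exists_coeff_of_fsNorm_lt hψ hd
  rw [← ϖ₁.coeff_tensor ϖ₂]
  refine (fsNorm_coeff_le _ (ContinuousHilbertField.tmulSection_mem_boundedSections hξ₁ hξ₂)
    (ContinuousHilbertField.tmulSection_mem_boundedSections hη₁ hη₂)).trans ?_
  refine (mul_le_mul (ContinuousHilbertField.sectionNorm_tmulSection_le hξ₁ hξ₂)
    (ContinuousHilbertField.sectionNorm_tmulSection_le hη₁ hη₂)
    (ContinuousHilbertField.sectionNorm_nonneg _ _)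
    (mul_nonneg (H₁.sectionNorm_nonneg _) (H₂.sectionNorm_nonneg _))).trans ?_
  rw [mul_mul_mul_comm]
  exact mul_le_mul h1.le h2.le
    (mul_nonneg (H₂.sectionNorm_nonneg _) (H₂.sectionNorm_nonneg _))
    ((fsNorm_nonneg _).trans hc.le)

theorem one_mem_fourierStieltjes : (1 : G → ℂ) ∈ fourierStieltjes G := by
  -- A one-dimensional Hilbert space in the universe of `G`, with its unit vector.
  set e : EuclideanSpace ℂ PUnit.{u + 1} := EuclideanSpace.single PUnit.unit 1 with he
  have hb : (fun _ => e) ∈ (ContinuousHilbertField.const (unitSpace G)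
      (EuclideanSpace ℂ PUnit.{u + 1})).boundedSections := by
    refine ⟨continuous_const (y := e), ‖e‖, ?_⟩
    rintro _ ⟨t, rfl⟩
    exact le_rfl
  refine ⟨_, GroupoidRep.trivial G (EuclideanSpace ℂ PUnit.{u + 1}), fun _ => e, hb,
    fun _ => e, hb, ?_⟩
  funext x
  change (1 : ℂ) = inner ℂ e e
  simp [he]

/-- The Fourier–Stieltjes algebra `B(𝒢)`. -/
def fourierStieltjesAlgebra (G : Type u) [AlgGroupoid G] [TopologicalSpace G]
    [TopologicalGroupoid G] : Subalgebra ℂ (G → ℂ) where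
  carrier := fourierStieltjes G
  mul_mem' := mul_mem_fourierStieltjes
  add_mem' := add_mem_fourierStieltjes
  algebraMap_mem' c := by
    rw [Algebra.algebraMap_eq_smul_one]
    exact smul_mem_fourierStieltjes c one_mem_fourierStieltjes

end FourierStieltjes

/-! ### Groups as groupoids with one unit -/

section Group

variable (K : Type u) [Group K]

/-- A group as a groupoid in which all pairs are composable. -/
@[reducible]
def groupAlgGroupoid : AlgGroupoid K where
  Comp _ _ := True
  inv_inv' := inv_inv
  assoc' a b c _ _ := ⟨trivial, trivial, mul_assoc a b c⟩
  comp_inv' _ := trivial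
  inv_mul_cancel_left' a b _ := inv_mul_cancel_left a b
  mul_inv_cancel_right' a b _ := mul_inv_cancel_right a b

attribute [local instance] groupAlgGroupoid

theorem groupAlgGroupoid.topologicalGroupoid [TopologicalSpace K] [IsTopologicalGroup K] :
    TopologicalGroupoid K where
  continuous_inv := continuous_inv
  continuousOn_mul := continuous_mul.continuousOn

theorem groupAlgGroupoid.subsingleton_unitSpace : Subsingleton (unitSpace K) := by
  refine ⟨?_⟩
  rintro ⟨_, a, rfl⟩ ⟨_, b, rfl⟩
  exact Subtype.ext ((mul_inv_cancel a).trans (mul_inv_cancel b).symm)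

attribute [local instance] groupAlgGroupoid.topologicalGroupoid
  groupAlgGroupoid.subsingleton_unitSpace

variable {K}

/-- A group is its own isotropy group. -/
def toIsotropy (w : unitSpace K) : K →* Isotropy w :=
  MonoidHom.mk' (fun x => ⟨x, Subsingleton.elim _ _, Subsingleton.elim _ _⟩) fun _ _ => rfl

variable [TopologicalSpace K]

/-- The groupoid representation on a constant field given by a group representation. -/
def UnitaryRep.toGroupoidRep {E : Type v} [NormedAddCommGroup E] [InnerProductSpace ℂ E]
    [CompleteSpace E] (π : UnitaryRep K E) :
    GroupoidRep K (ContinuousHilbertField.const (unitSpace K) E) where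
  map x := π.hom x.1
  continuous_coeff ξ _ η _ := by
    -- With a single unit every section is constant, so the coefficient is one of `π`.
    have h : ∀ (ζ : unitSpace K → E) (t : unitSpace K), ζ t = ζ (rng 1) := fun ζ t =>
      congrArg ζ (Subsingleton.elim _ _)
    refine (π.continuous_coeff (ξ (rng 1)) (η (rng 1))).congr fun x => ?_
    change inner ℂ (η (rng 1) : E) (π.hom x (ξ (rng 1) : E))
      = inner ℂ (η (rng x) : E) (π.hom x (ξ (src x) : E))
    rw [h ξ (src x), h η (rng x)]
    rfl
  map_comp x y w := congrArg (fun V => V w) (π.hom.map_mul x.1 y.1)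

/-- The group representation on a fibre given by a groupoid representation. -/
noncomputable def GroupoidRep.toUnitaryRep {H : ContinuousHilbertField.{u, v} (unitSpace K)}
    (ϖ : GroupoidRep K H) (w : unitSpace K) : UnitaryRep K (H.fiber w) where
  hom := (ϖ.restrict w).hom.comp (toIsotropy w)
  continuous_coeff ξ η := ((ϖ.restrict w).continuous_coeff ξ η).comp
    (Continuous.subtype_mk continuous_id _)

theorem sectionNorm_eq_norm (H : ContinuousHilbertField.{u, v} (unitSpace K))
    (ξ : ∀ t, H.fiber t) (w : unitSpace K) : H.sectionNorm ξ = ‖ξ w‖ :=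
  ciSup_subsingleton w fun t => ‖ξ t‖

theorem mem_boundedSections_of_group {H : ContinuousHilbertField.{u, v} (unitSpace K)}
    {ξ : ∀ t, H.fiber t} (hξ : ξ ∈ H.sections) : ξ ∈ H.boundedSections := by
  refine ⟨hξ, ‖ξ (rng 1)‖, ?_⟩
  rintro _ ⟨t, rfl⟩
  rw [Subsingleton.elim t (rng 1)]

/-- Coefficients of the group are the same as coefficients of the groupoid with one unit. -/
theorem exists_group_coeff_iff (φ : K → ℂ) (c : ℝ) :
    (∃ (E : Type u) (_ : NormedAddCommGroup E) (_ : InnerProductSpace ℂ E)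
      (_ : CompleteSpace E) (π : UnitaryRep K E) (ξ η : E),
        (φ = fun x => inner ℂ η (π.hom x ξ)) ∧ c = ‖ξ‖ * ‖η‖) ↔
    ∃ (H : ContinuousHilbertField.{u, u} (unitSpace K)) (ϖ : GroupoidRep K H),
      ∃ ξ ∈ H.boundedSections, ∃ η ∈ H.boundedSections,
        φ = ϖ.coeff ξ η ∧ c = H.sectionNorm ξ * H.sectionNorm η := by
  constructor
  · rintro ⟨E, _, _, _, π, ξ, η, rfl, rfl⟩
    have hb : ∀ ζ : E, (fun _ => ζ) ∈
        (ContinuousHilbertField.const (unitSpace K) E).boundedSections := fun ζ =>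
      mem_boundedSections_of_group (continuous_const (y := ζ))
    refine ⟨_, π.toGroupoidRep, fun _ => ξ, hb ξ, fun _ => η, hb η, rfl, ?_⟩
    exact (congrArg₂ (· * ·)
      (sectionNorm_eq_norm (ContinuousHilbertField.const (unitSpace K) E) (fun _ => ξ) (rng 1))
      (sectionNorm_eq_norm (ContinuousHilbertField.const (unitSpace K) E) (fun _ => η)
        (rng 1))).symm
  · rintro ⟨H, ϖ, ξ, -, η, -, rfl, rfl⟩
    refine ⟨H.fiber (rng 1), _, _, H.completeSpace _, ϖ.toUnitaryRep (rng 1), ξ (rng 1),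
      η (rng 1), ?_, ?_⟩
    · funext x
      exact ϖ.coeff_arrow (toIsotropy (rng 1) x) ξ η
    · rw [sectionNorm_eq_norm _ _ (rng 1), sectionNorm_eq_norm _ _ (rng 1)]

/-- Both infima run over the same set of reals, so the norm estimates for groupoids transfer to
groups. -/
theorem groupFsNorm_eq_fsNorm (φ : K → ℂ) : groupFsNorm φ = fsNorm φ :=
  congrArg sInf (Set.ext fun c => exists_group_coeff_iff φ c)

theorem groupFourierStieltjes_eq (K : Type u) [Group K] [TopologicalSpace K] :
    groupFourierStieltjes K = fourierStieltjes K := by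
  ext φ
  constructor
  · rintro ⟨E, _, _, _, π, ξ, η, h⟩
    obtain ⟨H, ϖ, ξ', hξ', η', hη', h', -⟩ :=
      (exists_group_coeff_iff φ _).1 ⟨E, _, _, inferInstance, π, ξ, η, h, rfl⟩
    exact ⟨H, ϖ, ξ', hξ', η', hη', h'⟩
  · rintro ⟨H, ϖ, ξ, hξ, η, hη, h⟩
    obtain ⟨E, _, _, _, π, ξ', η', h', -⟩ :=
      (exists_group_coeff_iff φ _).2 ⟨H, ϖ, ξ, hξ, η, hη, h, rfl⟩
    exact ⟨E, _, _, inferInstance, π, ξ', η', h'⟩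

theorem groupFsNorm_nonneg (φ : K → ℂ) : 0 ≤ groupFsNorm φ := by
  rw [groupFsNorm_eq_fsNorm]
  exact fsNorm_nonneg φ

variable [IsTopologicalGroup K]

/-- The Fourier–Stieltjes algebra `B(K)` of a group. -/
def groupFourierStieltjesAlgebra (K : Type u) [Group K] [TopologicalSpace K]
    [IsTopologicalGroup K] : Subalgebra ℂ (K → ℂ) :=
  fourierStieltjesAlgebra K

theorem coe_groupFourierStieltjesAlgebra :
    (groupFourierStieltjesAlgebra K : Set (K → ℂ)) = groupFourierStieltjes K :=
  (groupFourierStieltjes_eq K).symm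

theorem groupFsNorm_add_le {φ ψ : K → ℂ} (hφ : φ ∈ groupFourierStieltjesAlgebra K)
    (hψ : ψ ∈ groupFourierStieltjesAlgebra K) :
    groupFsNorm (φ + ψ) ≤ groupFsNorm φ + groupFsNorm ψ := by
  simp only [groupFsNorm_eq_fsNorm]
  exact fsNorm_add_le hφ hψ

theorem groupFsNorm_mul_le {φ ψ : K → ℂ} (hφ : φ ∈ groupFourierStieltjesAlgebra K)
    (hψ : ψ ∈ groupFourierStieltjesAlgebra K) :
    groupFsNorm (φ * ψ) ≤ groupFsNorm φ * groupFsNorm ψ := by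
  simp only [groupFsNorm_eq_fsNorm]
  exact fsNorm_mul_le hφ hψ

theorem groupFsNorm_smul_le (c : ℂ) {φ : K → ℂ} (hφ : φ ∈ groupFourierStieltjesAlgebra K) :
    groupFsNorm (c • φ) ≤ ‖c‖ * groupFsNorm φ := by
  simp only [groupFsNorm_eq_fsNorm]
  exact fsNorm_smul_le c hφ

end Group

/-! ### Closures in a normed function algebra -/

section Closure

variable {X : Type*}

/-- The closure of `C` in `B` for a submultiplicative seminorm `N` on `B`. -/
def seminormClosure (B : Subalgebra ℂ (X → ℂ)) (N : (X → ℂ) → ℝ) (N_nonneg : ∀ φ, 0 ≤ N φ)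
    (N_add : ∀ {φ ψ}, φ ∈ B → ψ ∈ B → N (φ + ψ) ≤ N φ + N ψ)
    (N_mul : ∀ {φ ψ}, φ ∈ B → ψ ∈ B → N (φ * ψ) ≤ N φ * N ψ)
    (N_smul : ∀ (c : ℂ) {φ}, φ ∈ B → N (c • φ) ≤ ‖c‖ * N φ)
    (C : NonUnitalSubalgebra ℂ (X → ℂ)) : NonUnitalSubalgebra ℂ (X → ℂ) where
  carrier := {φ | φ ∈ B ∧ ∀ ε : ℝ, 0 < ε → ∃ ψ ∈ C, φ - ψ ∈ B ∧ N (φ - ψ) < ε}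
  zero_mem' := by
    refine ⟨B.zero_mem, fun ε hε => ⟨0, C.zero_mem, ?_⟩⟩
    rw [sub_zero]
    refine ⟨B.zero_mem, lt_of_le_of_lt ?_ hε⟩
    simpa using N_smul 0 B.zero_mem
  add_mem' := by
    rintro φ₁ φ₂ ⟨h₁, a₁⟩ ⟨h₂, a₂⟩
    refine ⟨B.add_mem h₁ h₂, fun ε hε => ?_⟩
    obtain ⟨ψ₁, k₁, b₁, n₁⟩ := a₁ (ε / 2) (half_pos hε)
    obtain ⟨ψ₂, k₂, b₂, n₂⟩ := a₂ (ε / 2) (half_pos hε)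
    refine ⟨ψ₁ + ψ₂, C.add_mem k₁ k₂, ?_⟩
    rw [add_sub_add_comm]
    exact ⟨B.add_mem b₁ b₂, (N_add b₁ b₂).trans_lt (by linarith)⟩
  smul_mem' := by
    rintro c φ ⟨h, a⟩
    refine ⟨B.smul_mem h c, fun ε hε => ?_⟩
    have hc : (0 : ℝ) < ‖c‖ + 1 := by positivity
    obtain ⟨ψ, k, b, n⟩ := a (ε / (‖c‖ + 1)) (div_pos hε hc)
    refine ⟨c • ψ, C.smul_mem c k, ?_⟩
    rw [← smul_sub]
    refine ⟨B.smul_mem b c, (N_smul c b).trans_lt ?_⟩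
    rw [lt_div_iff₀ hc] at n
    nlinarith [N_nonneg (φ - ψ)]
  mul_mem' := by
    rintro φ₁ φ₂ ⟨h₁, a₁⟩ ⟨h₂, a₂⟩
    refine ⟨B.mul_mem h₁ h₂, fun ε hε => ?_⟩
    have hM : 0 < N φ₁ + N φ₂ + 1 := by linarith [N_nonneg φ₁, N_nonneg φ₂]
    -- The errors below add up to less than `δ * N φ₂ + N φ₁ * δ + δ`; the last term uses `δ ≤ 1`.
    set δ : ℝ := min 1 (ε / (N φ₁ + N φ₂ + 1)) with hδ
    have hδ0 : 0 < δ := lt_min one_pos (div_pos hε hM)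
    have hδ1 : δ ≤ 1 := min_le_left _ _
    have hδM : δ * (N φ₁ + N φ₂ + 1) ≤ ε := (le_div_iff₀ hM).1 (min_le_right _ _)
    obtain ⟨ψ₁, k₁, b₁, n₁⟩ := a₁ δ hδ0
    obtain ⟨ψ₂, k₂, b₂, n₂⟩ := a₂ δ hδ0
    refine ⟨ψ₁ * ψ₂, C.mul_mem k₁ k₂, ?_⟩
    -- This expansion involves only `φ₁`, `φ₂` and the differences, so no bound on `N ψ₁` or `N ψ₂`
    -- is needed. The scalar `-1` brings in `N_smul`, as `N` has no separate rule for subtraction.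
    have e : φ₁ * φ₂ - ψ₁ * ψ₂ = (φ₁ - ψ₁) * φ₂ + (φ₁ * (φ₂ - ψ₂)
        + (-1 : ℂ) • ((φ₁ - ψ₁) * (φ₂ - ψ₂))) := by
      rw [neg_one_smul]; ring
    have m₁ := B.mul_mem b₁ h₂
    have m₂ := B.mul_mem h₁ b₂
    have m₃ := B.mul_mem b₁ b₂
    have m₃' := B.smul_mem m₃ (-1)
    rw [e]
    refine ⟨B.add_mem m₁ (B.add_mem m₂ m₃'), ?_⟩
    have i₁ := N_add m₁ (B.add_mem m₂ m₃')
    have i₂ := N_add m₂ m₃'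
    have i₃ := N_smul (-1) m₃
    rw [norm_neg, norm_one, one_mul] at i₃
    have j₁ : N ((φ₁ - ψ₁) * φ₂) ≤ δ * N φ₂ :=
      (N_mul b₁ h₂).trans (mul_le_mul_of_nonneg_right n₁.le (N_nonneg _))
    have j₂ : N (φ₁ * (φ₂ - ψ₂)) ≤ N φ₁ * δ :=
      (N_mul h₁ b₂).trans (mul_le_mul_of_nonneg_left n₂.le (N_nonneg _))
    have j₃ : N ((φ₁ - ψ₁) * (φ₂ - ψ₂)) < δ * 1 :=
      (N_mul b₁ b₂).trans_lt (mul_lt_mul'' n₁ (n₂.trans_le hδ1) (N_nonneg _) (N_nonneg _))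
    linarith

/-- The compactly supported functions. -/
def compactlySupported (X : Type*) [TopologicalSpace X] : NonUnitalSubalgebra ℂ (X → ℂ) where
  carrier := {φ | HasCompactSupport φ}
  zero_mem' := HasCompactSupport.zero
  add_mem' h h' := h.add h'
  mul_mem' h _ := h.mul_right
  smul_mem' c _ h := h.comp_left (g := fun z => c • z) (smul_zero c)

end Closure

/-! ### Supports of the coefficients of the regular representation -/

section Support

variable {G : Type u} [AlgGroupoid G] [TopologicalSpace G] [TopologicalGroupoid G] [T2Space G]
  [MeasurableSpace G] (lam : HaarSystem G)

/-- If the integrand is nonzero at `z`, then `z ∈ supp g`, `x⁻¹ z ∈ supp f`, and `x = z (x⁻¹ z)⁻¹`.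
So `x` lies in the image of `P` under `(z, y) ↦ z y⁻¹`. Equality of sources is a closed condition,
which keeps `P` compact, and it makes `z` and `y⁻¹` composable, which makes the map continuous on
`P`. -/
theorem hasCompactSupport_regularCoeff {f g : G → ℂ} (hf : HasCompactSupport f)
    (hg : HasCompactSupport g) : HasCompactSupport (lam.regularCoeff f g) := by
  set P : Set (G × G) := (tsupport g ×ˢ tsupport f) ∩ {p | src p.1 = src p.2} with hP
  have hPc : IsCompact P := (hg.isCompact.prod hf.isCompact).inter_right
    (isClosed_eq (continuous_src.comp continuous_fst) (continuous_src.comp continuous_snd))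
  have hPm : ContinuousOn (fun p : G × G => p.1 * p.2⁻¹) P := by
    refine TopologicalGroupoid.continuousOn_mul.comp (t := {p : G × G | Comp p.1 p.2})
      (f := fun p : G × G => (p.1, p.2⁻¹)) ?_ fun p hp => ?_
    · exact (continuous_fst.prodMk
        (TopologicalGroupoid.continuous_inv.comp continuous_snd)).continuousOn
    · exact comp_of_src_eq_rng (hp.2.trans (rng_inv p.2).symm)
  refine HasCompactSupport.intro (hPc.image_of_continuousOn hPm) fun x hx => ?_
  refine MeasureTheory.integral_eq_zero_of_ae (.of_forall fun z => ?_)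
  by_contra hne
  rw [Pi.zero_apply] at hne
  obtain ⟨hfz, hgz⟩ := mul_ne_zero_iff.1 hne
  have hgz' : g z.1 ≠ 0 := fun h => hgz (by rw [h, map_zero])
  have hc : Comp x⁻¹ z.1 := comp_of_src_eq_rng ((src_inv x).trans z.2.symm)
  have hs : src (x⁻¹ * z.1) = src z.1 := src_mul hc
  refine hx ⟨(z.1, x⁻¹ * z.1), ⟨⟨subset_tsupport _ hgz', subset_tsupport _ hfz⟩, hs.symm⟩, ?_⟩
  have hc' : Comp x (x⁻¹ * z.1) := comp_of_src_eq_rng (by rw [rng_mul hc, rng_inv])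
  have h1 : x * (x⁻¹ * z.1) = z.1 := by
    simpa only [inv_inv'] using inv_mul_cancel_left' x⁻¹ z.1 hc
  have h2 := mul_inv_cancel_right' x (x⁻¹ * z.1) hc'
  rwa [h1] at h2

/-- The compactly supported functions form an algebra containing the generators. -/
theorem fourierCore_le_compactlySupported : lam.fourierCore ≤ compactlySupported G := by
  refine NonUnitalAlgebra.adjoin_le ?_
  rintro _ ⟨f, g, -, hf, -, hg, rfl⟩
  exact hasCompactSupport_regularCoeff lam hf hg

end Support

/-! ### Restriction to an isotropy group -/

section Restriction

variable {G : Type u} [AlgGroupoid G] [TopologicalSpace G]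

theorem restrict_mem_groupFourierStieltjes (w : unitSpace G) {φ : G → ℂ}
    (hφ : φ ∈ fourierStieltjes G) :
    (fun x : Isotropy w => φ x.1) ∈ groupFourierStieltjes (Isotropy w) := by
  obtain ⟨H, ϖ, ξ, -, η, -, rfl⟩ := hφ
  exact ⟨H.fiber w, _, _, H.completeSpace w, ϖ.restrict w, ξ w, η w,
    funext fun x => ϖ.coeff_arrow x ξ η⟩

/-- Any factorization of `φ` by sections restricts to one by their values at `w`, whose norms are at
most the suprema. -/
theorem groupFsNorm_restrict_le (w : unitSpace G) {φ : G → ℂ} (hφ : φ ∈ fourierStieltjes G) :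
    groupFsNorm (fun x : Isotropy w => φ x.1) ≤ fsNorm φ := by
  refine le_of_forall_gt_imp_ge_of_dense fun c hc => ?_
  obtain ⟨H, ϖ, ξ, hξ, η, hη, rfl, h⟩ := exists_coeff_of_fsNorm_lt hφ hc
  have hle : groupFsNorm (fun x : Isotropy w => ϖ.coeff ξ η x.1) ≤ ‖ξ w‖ * ‖η w‖ := by
    refine csInf_le ⟨0, ?_⟩ ⟨H.fiber w, _, _, H.completeSpace w, ϖ.restrict w, ξ w, η w,
      funext fun x => ϖ.coeff_arrow x ξ η, rfl⟩
    rintro _ ⟨E, _, _, _, π, ξ, η, -, rfl⟩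
    positivity
  exact (hle.trans (mul_le_mul (H.norm_le_sectionNorm hξ w) (H.norm_le_sectionNorm hη w)
    (norm_nonneg _) (H.sectionNorm_nonneg ξ))).trans h.le

variable [TopologicalGroupoid G]

/-- The restriction homomorphism `B(𝒢) → B(𝒢_w^w)`. -/
def restrictFourierStieltjes (w : unitSpace G) :
    fourierStieltjesAlgebra G →ₐ[ℂ] groupFourierStieltjesAlgebra (Isotropy w) where
  toFun φ := ⟨fun x => φ.1 x.1, by
    have h := restrict_mem_groupFourierStieltjes w φ.2
    rwa [← coe_groupFourierStieltjesAlgebra] at h⟩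
  map_one' := rfl
  map_mul' _ _ := rfl
  map_zero' := rfl
  map_add' _ _ := rfl
  commutes' _ := rfl

/-- The Fourier algebra `A(𝒢)`. -/
noncomputable def fourierAlgebra [MeasurableSpace G] (lam : HaarSystem G) :
    NonUnitalSubalgebra ℂ (G → ℂ) :=
  seminormClosure (fourierStieltjesAlgebra G) fsNorm fsNorm_nonneg fsNorm_add_le fsNorm_mul_le
    fsNorm_smul_le lam.fourierCore

/-- The Fourier algebra `A(K)` of a group. -/
noncomputable def groupFourierAlgebra (K : Type u) [Group K] [TopologicalSpace K]
    [IsTopologicalGroup K] : NonUnitalSubalgebra ℂ (K → ℂ) :=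
  seminormClosure (groupFourierStieltjesAlgebra K) groupFsNorm groupFsNorm_nonneg
    groupFsNorm_add_le groupFsNorm_mul_le groupFsNorm_smul_le
    ((groupFourierStieltjesAlgebra K).toNonUnitalSubalgebra ⊓ compactlySupported K)

theorem coe_groupFourierAlgebra (K : Type u) [Group K] [TopologicalSpace K]
    [IsTopologicalGroup K] : (groupFourierAlgebra K : Set (K → ℂ)) = groupFourier K := by
  have h : ∀ φ : K → ℂ, φ ∈ groupFourierStieltjesAlgebra K ↔ φ ∈ groupFourierStieltjes K :=
    fun φ => by rw [← coe_groupFourierStieltjesAlgebra]; rfl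
  ext φ
  constructor
  · rintro ⟨hφ, a⟩
    refine ⟨(h φ).1 hφ, fun ε hε => ?_⟩
    obtain ⟨ψ, ⟨hψ, hc⟩, hm, hn⟩ := a ε hε
    exact ⟨ψ, (h ψ).1 hψ, hc, (h _).1 hm, hn⟩
  · rintro ⟨hφ, a⟩
    refine ⟨(h φ).2 hφ, fun ε hε => ?_⟩
    obtain ⟨ψ, hψ, hc, hm, hn⟩ := a ε hε
    exact ⟨ψ, ⟨(h ψ).2 hψ, hc⟩, (h _).2 hm, hn⟩

theorem restrict_mem_groupFourier [T2Space G] [MeasurableSpace G] (lam : HaarSystem G)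
    (w : unitSpace G) {φ : G → ℂ} (hφ : φ ∈ lam.fourier) :
    (fun x : Isotropy w => φ x.1) ∈ groupFourier (Isotropy w) := by
  refine ⟨restrict_mem_groupFourierStieltjes w hφ.1, fun ε hε => ?_⟩
  obtain ⟨ψ, hψ, hm, hn⟩ := hφ.2 ε hε
  -- The definition of `A(𝒢)` places `φ` and `φ - ψ` in `B(𝒢)`; their difference recovers `ψ`.
  have hψB : ψ ∈ fourierStieltjesAlgebra G := by
    have h := (fourierStieltjesAlgebra G).sub_mem (x := φ) (y := φ - ψ) hφ.1 hm
    rwa [sub_sub_cancel] at h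
  exact ⟨fun x => ψ x.1, restrict_mem_groupFourierStieltjes w hψB,
    (fourierCore_le_compactlySupported lam hψ : HasCompactSupport ψ).comp_isClosedEmbedding
      (isClosed_isotropy w).isClosedEmbedding_subtypeVal,
    restrict_mem_groupFourierStieltjes w hm, (groupFsNorm_restrict_le w hm).trans_lt hn⟩

/-- The restriction homomorphism `A(𝒢) → A(𝒢_w^w)`. -/
noncomputable def restrictFourier [T2Space G] [MeasurableSpace G] (lam : HaarSystem G)
    (w : unitSpace G) : fourierAlgebra lam →ₙₐ[ℂ] groupFourierAlgebra (Isotropy w) where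
  toFun φ := ⟨fun x => φ.1 x.1, by
    have h := restrict_mem_groupFourier lam w φ.2
    rwa [← coe_groupFourierAlgebra] at h⟩
  map_smul' _ _ := rfl
  map_zero' := rfl
  map_add' _ _ := rfl
  map_mul' _ _ := rfl

end Restriction

end GroupoidFourier

/-! ### The restriction theorem. -/

theorem mainTheorem2 {G : Type u} [AlgGroupoid G] [TopologicalSpace G] [TopologicalGroupoid G]
    [LocallyCompactSpace G] [T2Space G] (w : unitSpace G) :
    -- restriction of representations
    (∀ (H : ContinuousHilbertField.{u, v} (unitSpace G)) (ϖ : GroupoidRep G H),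
      ∃ π : UnitaryRep (Isotropy w) (H.fiber w), ∀ x : Isotropy w, π.hom x = ϖ.map x) ∧
    -- restriction `B(𝒢) → B(𝒢_w^w)`
    (∃ (B : Subalgebra ℂ (G → ℂ)) (B' : Subalgebra ℂ (Isotropy w → ℂ)),
      (B : Set (G → ℂ)) = fourierStieltjes G ∧
      (B' : Set (Isotropy w → ℂ)) = groupFourierStieltjes (Isotropy w) ∧
      ∃ R : B →ₐ[ℂ] B',
        (∀ (φ : B) (x : Isotropy w), (R φ : Isotropy w → ℂ) x = (φ : G → ℂ) x.1) ∧
        ∀ φ : B, groupFsNorm (R φ : Isotropy w → ℂ) ≤ fsNorm (φ : G → ℂ)) ∧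
    -- restriction `A(𝒢) → A(𝒢_w^w)`
    (∀ [MeasurableSpace G] [BorelSpace G] (lam : HaarSystem G),
      ∃ (A : NonUnitalSubalgebra ℂ (G → ℂ)) (A' : NonUnitalSubalgebra ℂ (Isotropy w → ℂ)),
        (A : Set (G → ℂ)) = lam.fourier ∧
        (A' : Set (Isotropy w → ℂ)) = groupFourier (Isotropy w) ∧
        ∃ R : A →ₙₐ[ℂ] A',
          (∀ (φ : A) (x : Isotropy w), (R φ : Isotropy w → ℂ) x = (φ : G → ℂ) x.1) ∧
          ∀ φ : A, groupFsNorm (R φ : Isotropy w → ℂ) ≤ fsNorm (φ : G → ℂ)) := by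
  refine ⟨fun H ϖ => ⟨ϖ.restrict w, fun _ => rfl⟩, ?_, fun lam => ?_⟩
  · exact ⟨fourierStieltjesAlgebra G, groupFourierStieltjesAlgebra (Isotropy w), rfl,
      coe_groupFourierStieltjesAlgebra, restrictFourierStieltjes w, fun _ _ => rfl,
      fun φ => groupFsNorm_restrict_le w φ.2⟩
  · exact ⟨fourierAlgebra lam, groupFourierAlgebra (Isotropy w), rfl, coe_groupFourierAlgebra _,
      restrictFourier lam w, fun _ _ => rfl, fun φ => groupFsNorm_restrict_le w φ.2.1⟩
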